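/- **Proposition (Access Probability).** Let $P_1,P_2,\lambda_1,d,I,\theta>0$ and $\alpha>2$. A secondary transmitter (TX) sits at the origin of the plane, and its receiver (RX) sits at a point $z$ with $|z|=d$. *Empty-ball model with radius $R>0$* (the conditional law of the primary network given the sensed interference level): the nearest primary TX is at $T_1=R(\cos\Theta,\sin\Theta)$ with $\Theta$ uniform on $[0,2\pi]$; the other primary TXs $x_0,x_1,\dots$ form a Poisson point process of density $\lambda_1$ on $\{|x|>R\}$; the fading gains $h^{(0)}$ (secondary TX to RX), $h$ (from $T_1$) and $h_0,h_1,\dots$ (from $x_0,x_1,\dots$) are i.i.d. exponential with mean $1$; and $\Theta$, the point process and the fading gains are independent. All primary TXs transmit with power $P_1$, the secondary TX with power $P_2$, and all other secondary TXs are silent. The primary interference at $w$ is $$J(w)=P_1\Big(h\,|T_1-w|^{-\alpha}+\sum_i h_i\,|x_i-w|^{-\alpha}\Big).$$ The radius $R$ is *matched to the sensed level $I$*, and is then written $R_I$, if the mean interference at the secondary TX is $\mathsf E[J(0)]=I$. The access probability is $$\phi_2(I,\theta)=\mathsf P\left[\frac{P_2h^{(0)}d^{-\alpha}}{J(z)}>\theta\right]$$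 in the empty-ball model with radius $R_I$. Then: 1. A radius $R>0$ is matched to $I$ if and only if it satisfies $$\frac{I}{P_1}R^\alpha-\frac{2\pi\lambda_1}{\alpha-2}R^2-1=0,$$ and this equation has exactly one positive solution $R=R_I$. 2. $\phi_2(I,\theta)=\mathcal P_s(R_I,\theta)$ for every $z$ with $|z|=d$, where $$\begin{aligned}\mathcal P_s(R,\theta)={}&\frac1{2\pi}\int_0^{2\pi}\frac{P_2}{P_2+P_1\theta d^\alpha\left(R^2-2dR\cos t+d^2\right)^{-\alpha/2}}\,dt\\&\times\exp\Bigg(-\lambda_1\Bigg[\int_{R+d}^\infty\frac{2\pi P_1\theta d^\alpha y^{-\alpha+1}}{P_2+P_1\theta d^\alpha y^{-\alpha}}\,dy+\int_{|R-d|}^{R+d}\frac{2\arccos\left(\frac{R^2-d^2-y^2}{2dy}\right)P_1\theta d^\alpha y^{-\alpha+1}}{P_2+P_1\theta d^\alpha y^{-\alpha}}\,dy\\&\qquad\qquad\qquad+\int_{\max(0,R-d)}^{|R-d|}\frac{2\pi P_1\theta d^\alpha y^{-\alpha+1}}{P_2+P_1\theta d^\alpha y^{-\alpha}}\,dy\Bigg]\Bigg),\end{aligned}$$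 and all four integrals converge for every $R>0$. 3. If $\alpha=4$, then $$R_I=(2I)^{-\frac12}\left(\pi\lambda_1P_1+\left[(\pi\lambda_1P_1)^2+4P_1I\right]^{\frac12}\right)^{\frac12}.$$ -/

import Mathlib

open MeasureTheory ProbabilityTheory
open scoped ENNReal

noncomputable section

namespace SenseAndPredict

variable {Ω : Type*} [MeasurableSpace Ω]

/-- The number of indices `i` for which the random point `X i` lies in `B`. -/
def pointCount {E : Type*} (X : ℕ → Ω → E) (B : Set E) (ω : Ω) : ℕ∞ :=
  {i | X i ω ∈ B}.encard

/-- The points `X 0, X 1, …` form (an enumeration, in no particular order, of) a Poisson point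
process with intensity measure `ν`: the number of points in a measurable set `B` of finite
intensity is Poisson distributed with mean `ν B`, and the numbers of points in pairwise disjoint
measurable sets are independent. (The enumeration is by all of `ℕ`, so this is meant for
intensities of infinite total mass, for which there are almost surely infinitely many points.) -/
structure IsPoissonPointProcess {E : Type*} [MeasurableSpace E]
    (X : ℕ → Ω → E) (ν : Measure E) (μ : Measure Ω) : Prop where
  measurable : ∀ i, Measurable (X i)
  count_law : ∀ B : Set E, MeasurableSet B → ν B ≠ ∞ → ∀ n : ℕ,
    μ {ω | pointCount X B ω = n} = poissonMeasure (ν B).toNNReal {n}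
  count_indep : ∀ (n : ℕ) (B : Fin n → Set E), (∀ j, MeasurableSet (B j)) →
    Pairwise (fun j k => Disjoint (B j) (B k)) →
    iIndepFun (fun j => pointCount X (B j)) μ

/-- The radio links that end at the secondary receiver or at the secondary transmitter:
the desired link, the link from the nearest primary transmitter, and the links from the
other primary transmitters. -/
inductive Link : Type
  | desired : Link
  | nearest : Link
  | other (i : ℕ) : Link

/-- The empty-ball model with density `lam` and radius `R`. The plane is `ℂ` and the secondary
transmitter sits at the origin. The measure `μ` is the conditional probability given the level
sensed by the secondary transmitter.

* The nearest primary transmitter is on the circle of radius `R`, at a uniform angle.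
* The other primary transmitters form a Poisson point process with density `lam` outside the
  ball of radius `R`.
* The fading gains of all links are i.i.d. exponential with mean one.
* Angle, point process and fading gains are independent. -/
structure EmptyBallModel (μ : Measure Ω) (lam R : ℝ) where
  /-- angle at which the secondary transmitter sees its nearest primary transmitter -/
  angle : Ω → ℝ
  /-- positions of the other primary transmitters -/
  pos : ℕ → Ω → ℂ
  /-- fading gains -/
  fading : Link → Ω → ℝ
  angle_measurable : Measurable angle
  angle_law : pdf.IsUniform angle (Set.Icc 0 (2 * Real.pi)) μ volume
  pos_poisson : IsPoissonPointProcess pos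
    (ENNReal.ofReal lam • (volume : Measure ℂ).restrict (Metric.closedBall 0 R)ᶜ) μ
  fading_measurable : ∀ l, Measurable (fading l)
  fading_law : ∀ l, HasLaw (fading l) (expMeasure 1) μ
  fading_indep : iIndepFun fading μ
  indep_angle_pos : IndepFun angle (fun ω i => pos i ω) μ
  indep_fading : IndepFun (fun ω => (angle ω, fun i => pos i ω)) (fun ω l => fading l ω) μ

namespace EmptyBallModel

variable {μ : Measure Ω} {lam R : ℝ}

/-- Position of the primary transmitter nearest to the secondary transmitter. -/
def nearestPos (M : EmptyBallModel μ lam R) (ω : Ω) : ℂ :=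
  R * Complex.exp (M.angle ω * Complex.I)

/-- Aggregate interference at the point `z` from all primary transmitters, each of which is
transmitting with power `P₁`, under path-loss exponent `α`. -/
def interference (M : EmptyBallModel μ lam R) (P₁ α : ℝ) (z : ℂ) (ω : Ω) : ℝ≥0∞ :=
  ENNReal.ofReal P₁ *
    (ENNReal.ofReal (M.fading Link.nearest ω) * ‖M.nearestPos ω - z‖ₑ ^ (-α) +
      ∑' i, ENNReal.ofReal (M.fading (Link.other i) ω) * ‖M.pos i ω - z‖ₑ ^ (-α))

/-- The model agrees with the level `I` sensed at the secondary transmitter: the mean aggregate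
primary interference at the origin is `I`. -/
def SensesLevel (M : EmptyBallModel μ lam R) (P₁ α I : ℝ) : Prop :=
  ∫⁻ ω, M.interference P₁ α 0 ω ∂μ = ENNReal.ofReal I

/-- Signal-to-interference ratio at the secondary receiver at `z`, whose transmitter sits at the
origin and sends with power `P₂`, while all other secondary transmitters are silent. -/
def sir (M : EmptyBallModel μ lam R) (P₁ P₂ α : ℝ) (z : ℂ) (ω : Ω) : ℝ≥0∞ :=
  ENNReal.ofReal P₂ * ENNReal.ofReal (M.fading Link.desired ω) * ‖z‖ₑ ^ (-α) /
    M.interference P₁ α z ω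

/-- Access probability: the probability that the signal-to-interference ratio at the secondary
receiver at `z` exceeds the access threshold `θ`. -/
def accessProb (M : EmptyBallModel μ lam R) (P₁ P₂ α : ℝ) (z : ℂ) (θ : ℝ) : ℝ :=
  μ.real {ω | ENNReal.ofReal θ < M.sir P₁ P₂ α z ω}

end EmptyBallModel

/-- Integrand of the angular average over the nearest primary transmitter. -/
def angularIntegrand (P₁ P₂ α d R θ t : ℝ) : ℝ :=
  P₂ / (P₂ + P₁ * θ * d ^ α * (R ^ 2 - 2 * d * R * Real.cos t + d ^ 2) ^ (-α / 2))

/-- Integrand on the distances `y` from the receiver at which the whole circle of radius `y` is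
outside the empty ball. -/
def fullIntegrand (P₁ P₂ α d θ y : ℝ) : ℝ :=
  2 * Real.pi * (P₁ * θ) * d ^ α * y ^ (-α + 1) / (P₂ + P₁ * θ * d ^ α * y ^ (-α))

/-- Integrand on the distances `y` from the receiver at which the circle of radius `y` is partly
outside the empty ball. -/
def arcIntegrand (P₁ P₂ α d R θ y : ℝ) : ℝ :=
  2 * Real.arccos ((R ^ 2 - d ^ 2 - y ^ 2) / (2 * d * y)) * (P₁ * θ) * d ^ α * y ^ (-α + 1) /
    (P₂ + P₁ * θ * d ^ α * y ^ (-α))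

/-- The explicit expression for the access probability. -/
def Ps (P₁ P₂ lam₁ α d R θ : ℝ) : ℝ :=
  (1 / (2 * Real.pi) * ∫ t in (0 : ℝ)..(2 * Real.pi), angularIntegrand P₁ P₂ α d R θ t) *
    Real.exp (-lam₁ *
      ((∫ y in Set.Ioi (R + d), fullIntegrand P₁ P₂ α d θ y) +
        (∫ y in |R - d|..(R + d), arcIntegrand P₁ P₂ α d R θ y) +
        ∫ y in (max 0 (R - d))..|R - d|, fullIntegrand P₁ P₂ α d θ y))

/-- The equation for the radius of the empty ball. -/
def RadiusEquation (P₁ lam₁ α I R : ℝ) : Prop :=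
  I / P₁ * R ^ α - 2 * Real.pi * lam₁ / (α - 2) * R ^ 2 - 1 = 0

end SenseAndPredict

end

/-! Put `s = P₁ θ d^α / P₂`. The ratio at the receiver exceeds `θ` exactly when the desired gain
exceeds `Y`, the sum of the interfering gains weighted by `s` times their path gains. The desired
gain is unit exponential and independent of `Y`, so this has probability `E[exp (-Y)]`. With the
positions frozen, each interfering gain at distance `r` contributes its Laplace transform `1 / (1 +
s r^(-α))`. The nearest transmitter and the others are independent, so the expectation splits
(`measure_lt_sir`): the former gives the angular average, and the Laplace functional of the Poisson
process (`IsPoissonPointProcess.laplace`) turns the latter into `exp (-λ ∫ (1 - 1 / (1 + s |x -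
z|^(-α))) dx)` over the exterior of the ball.

Polar coordinates about `z` evaluate the exponent (`lintegral_radial_exterior`): the part of the
circle of radius `y` outside the ball is an arc of angle `2 arccos ((R² - d² - y²) / (2dy))`. Since
`arccos` is constant beyond `±1`, this formula also covers circles entirely outside or inside the
ball. One integral over `(0, ∞)` thus carries everything, and cutting it at `|R - d|` and `R + d`
gives the three stated integrals (`integral_arcIntegrand`).

For the radius, Campbell's formula gives mean interference `P₁ (R^(-α) + 2πλ/(α-2) R^(2-α))` at the
origin; equating it with `I` and clearing powers is the radius equation. Divided by `R²`, that
equation has a strictly increasing side and a strictly decreasing one, hence at most one root; a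
root exists by continuity. For `α = 4` it is quadratic in `R²`.

Sums and expectations are kept in `[0, ∞]`, so almost sure finiteness of the interference never has
to be shown. -/

open MeasureTheory ProbabilityTheory
open scoped ENNReal

noncomputable section

namespace SenseAndPredict

/-! ### Laplace transforms on `[0, ∞]` and independence -/

section Laplace

variable {Ω : Type*} [MeasurableSpace Ω]

/-- The function `x ↦ exp (-x)` on `[0, ∞]`, with value `0` at `∞`. -/
def expNeg (x : ℝ≥0∞) : ℝ≥0∞ := EReal.exp (-(x : EReal))

lemma expNeg_zero : expNeg 0 = 1 := by simp [expNeg]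

lemma expNeg_top : expNeg ∞ = 0 := by simp [expNeg]

lemma expNeg_ofReal {r : ℝ} (hr : 0 ≤ r) :
    expNeg (ENNReal.ofReal r) = ENNReal.ofReal (Real.exp (-r)) := by
  rw [expNeg, EReal.coe_ennreal_ofReal, max_eq_left hr, ← EReal.coe_neg, EReal.exp_coe]

lemma expNeg_add (x y : ℝ≥0∞) : expNeg (x + y) = expNeg x * expNeg y := by
  rw [expNeg, EReal.coe_ennreal_add, EReal.neg_add (.inl (EReal.coe_ennreal_ne_bot _))
    (.inr (EReal.coe_ennreal_ne_bot _)), sub_eq_add_neg, EReal.exp_add]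
  rfl

lemma expNeg_sum {ι : Type*} (s : Finset ι) (f : ι → ℝ≥0∞) :
    expNeg (∑ i ∈ s, f i) = ∏ i ∈ s, expNeg (f i) := by
  classical
  induction s using Finset.induction_on with
  | empty => simp [expNeg_zero]
  | insert i s hi ih => rw [Finset.sum_insert hi, Finset.prod_insert hi, expNeg_add, ih]

lemma continuous_expNeg : Continuous expNeg :=
  ENNReal.continuous_exp.comp (continuous_neg.comp continuous_coe_ennreal_ereal)

lemma measurable_expNeg : Measurable expNeg := continuous_expNeg.measurable

lemma antitone_expNeg : Antitone expNeg := fun _ _ h =>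
  EReal.exp_monotone (EReal.neg_le_neg_iff.2 (EReal.coe_ennreal_le_coe_ennreal_iff.2 h))

lemma expNeg_le_one (x : ℝ≥0∞) : expNeg x ≤ 1 :=
  expNeg_zero ▸ antitone_expNeg (zero_le (a := x))

/-- A section of `expNeg` over `[0, 1]`. -/
def negLog (u : ℝ≥0∞) : ℝ≥0∞ := (-(ENNReal.log u)).toENNReal

/-- Serves to write a product of factors in `[0, 1]` as `expNeg` of a sum, the shape the Laplace
functional requires. A factor `0` is allowed, as its `negLog` is `∞`. -/
lemma expNeg_negLog {u : ℝ≥0∞} (hu : u ≤ 1) : expNeg (negLog u) = u := by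
  rw [expNeg, negLog, EReal.coe_toENNReal, neg_neg, ENNReal.exp_log]
  rw [EReal.le_neg, neg_zero]
  exact ENNReal.log_le_zero_iff.2 hu

lemma measurable_negLog : Measurable negLog :=
  (ENNReal.measurable_log.neg).ereal_toENNReal

lemma expNeg_tsum_tendsto (f : ℕ → ℝ≥0∞) :
    Filter.Tendsto (fun n => ∏ i ∈ Finset.range n, expNeg (f i)) Filter.atTop
      (nhds (expNeg (∑' i, f i))) := by
  simp_rw [← expNeg_sum]
  exact (continuous_expNeg.tendsto _).comp (ENNReal.tendsto_nat_tsum f)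

/-- Bounded convergence for `[0, ∞]`-valued functions under a probability measure. -/
lemma tendsto_lintegral_of_le_one {μ : Measure Ω} [IsProbabilityMeasure μ]
    {F : ℕ → Ω → ℝ≥0∞} {f : Ω → ℝ≥0∞} (hF : ∀ n, Measurable (F n)) (h1 : ∀ n ω, F n ω ≤ 1)
    (h : ∀ ω, Filter.Tendsto (fun n => F n ω) Filter.atTop (nhds (f ω))) :
    Filter.Tendsto (fun n => ∫⁻ ω, F n ω ∂μ) Filter.atTop (nhds (∫⁻ ω, f ω ∂μ)) :=
  tendsto_lintegral_of_dominated_convergence (fun _ => 1) hF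
    (fun n => Filter.Eventually.of_forall (h1 n)) (by simp) (Filter.Eventually.of_forall h)

lemma lintegral_finset_prod_of_iIndepFun {ι : Type*} {μ : Measure Ω} [IsProbabilityMeasure μ]
    {f : ι → Ω → ℝ≥0∞} (hf : ∀ i, Measurable (f i)) (hi : iIndepFun f μ) (s : Finset ι) :
    ∫⁻ ω, ∏ i ∈ s, f i ω ∂μ = ∏ i ∈ s, ∫⁻ ω, f i ω ∂μ := by
  classical
  induction s using Finset.induction_on with
  | empty => simp
  | insert i s his ih =>
    have h := (hi.indepFun_finsetProd_of_notMem hf his).symm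
    have h2 := lintegral_mul_eq_lintegral_mul_lintegral_of_indepFun (hf i)
      (by fun_prop) h
    simp only [Pi.mul_apply, Finset.prod_apply] at h2
    simp_rw [Finset.prod_insert his, h2, ih]

/-- Integrating a function of two independent random variables. -/
lemma lintegral_of_indepFun {E F : Type*} [MeasurableSpace E] [MeasurableSpace F]
    {μ : Measure Ω} [IsProbabilityMeasure μ] {X : Ω → E} {Y : Ω → F} (hX : Measurable X)
    (hY : Measurable Y) (h : IndepFun X Y μ) {Φ : E → F → ℝ≥0∞}
    (hΦ : Measurable (Function.uncurry Φ)) :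
    ∫⁻ ω, Φ (X ω) (Y ω) ∂μ = ∫⁻ ω, ∫⁻ ω', Φ (X ω) (Y ω') ∂μ ∂μ := by
  have := Measure.isProbabilityMeasure_map (μ := μ) hX.aemeasurable
  have := Measure.isProbabilityMeasure_map (μ := μ) hY.aemeasurable
  calc ∫⁻ ω, Φ (X ω) (Y ω) ∂μ
      = ∫⁻ p, Function.uncurry Φ p ∂(μ.map fun ω => (X ω, Y ω)) :=
        (lintegral_map hΦ (hX.prodMk hY)).symm
    _ = ∫⁻ x, ∫⁻ y, Φ x y ∂(μ.map Y) ∂(μ.map X) := by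
        rw [h.map_prod_eq_prod_map_map hX.aemeasurable hY.aemeasurable,
          lintegral_prod _ hΦ.aemeasurable]
        rfl
    _ = ∫⁻ ω, ∫⁻ y, Φ (X ω) y ∂(μ.map Y) ∂μ :=
        lintegral_map hΦ.lintegral_prod_right hX
    _ = _ := by
        refine lintegral_congr fun ω => lintegral_map ?_ hY
        exact hΦ.comp measurable_prodMk_left

/-! ### The unit exponential law -/

section Exponential

lemma expMeasure_one_eq : expMeasure 1 = volume.withDensity (exponentialPDF 1) := rfl

lemma expMeasure_one_Iic_zero : expMeasure 1 (Set.Iic 0) = 0 := by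
  rw [expMeasure_one_eq, withDensity_apply _ measurableSet_Iic,
    lintegral_exponentialPDF_eq_antiDeriv one_pos]
  simp

lemma expMeasure_one_Ioi {x : ℝ} (hx : 0 ≤ x) :
    expMeasure 1 (Set.Ioi x) = ENNReal.ofReal (Real.exp (-x)) := by
  have := isProbabilityMeasure_expMeasure (r := 1) one_pos
  rw [← Set.compl_Iic, prob_compl_eq_one_sub measurableSet_Iic, expMeasure_one_eq,
    withDensity_apply _ measurableSet_Iic, lintegral_exponentialPDF_eq_antiDeriv one_pos,
    if_pos hx, ← ENNReal.ofReal_one, ← ENNReal.ofReal_sub _ (by simpa using hx)]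
  simp

/-- This tail formula is what converts the event that the desired gain beats the interference into a
Laplace transform. An infinite threshold fits in, with both sides zero. -/
lemma expMeasure_one_lt_ofReal (x : ℝ≥0∞) :
    expMeasure 1 {h | x < ENNReal.ofReal h} = expNeg x := by
  rcases eq_or_ne x ∞ with rfl | hx
  · simp [expNeg_top]
  · have : {h | x < ENNReal.ofReal h} = Set.Ioi x.toReal := by
      ext h
      simp [ENNReal.lt_ofReal_iff_toReal_lt hx]
    rw [this, expMeasure_one_Ioi ENNReal.toReal_nonneg, ← expNeg_ofReal ENNReal.toReal_nonneg,
      ENNReal.ofReal_toReal hx]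

/-- Laplace transform of the unit exponential law. -/
lemma lintegral_expNeg_mul_expMeasure (a : ℝ≥0∞) :
    ∫⁻ h, expNeg (ENNReal.ofReal h * a) ∂(expMeasure 1) = (1 + a)⁻¹ := by
  rcases eq_or_ne a ∞ with rfl | ha
  -- The gain is almost surely positive, so an infinite weight makes the integrand vanish almost
  -- everywhere.
  · simp only [add_top, ENNReal.inv_top]
    rw [lintegral_eq_zero_iff' (by
      exact (measurable_expNeg.comp (by fun_prop)).aemeasurable)]
    have : ∀ᵐ h ∂(expMeasure 1), h ∉ Set.Iic (0 : ℝ) :=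
      measure_eq_zero_iff_ae_notMem.1 expMeasure_one_Iic_zero
    filter_upwards [this] with h hh
    have : ENNReal.ofReal h ≠ 0 := by simpa using hh
    simp [ENNReal.mul_top this, expNeg_top]
  · lift a to NNReal using ha
    have hr : (0 : ℝ) < 1 + a := by positivity
    rw [expMeasure_one_eq, lintegral_withDensity_eq_lintegral_mul _ (by
      exact (measurable_exponentialPDFReal 1).ennreal_ofReal)
      (show Measurable fun h : ℝ => expNeg (ENNReal.ofReal h * a) from
        measurable_expNeg.comp (by fun_prop))]
    -- Tilting the rate-one density by `exp (-a h)` gives, up to the factor `1 / (1 + a)`, the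
    -- density of rate `1 + a`, which integrates to one.
    have h1 : ∀ x, (exponentialPDF 1 * fun h => expNeg (ENNReal.ofReal h * a)) x
        = (1 + (a : ℝ≥0∞))⁻¹ * exponentialPDF (1 + a) x := by
      intro x
      have e : (1 + (a : ℝ≥0∞)) = ENNReal.ofReal (1 + a) := by
        rw [ENNReal.ofReal_add zero_le_one a.coe_nonneg]; simp
      rcases lt_or_ge x 0 with hx | hx
      · simp [exponentialPDF_of_neg hx]
      · rw [Pi.mul_apply, exponentialPDF_of_nonneg hx, exponentialPDF_of_nonneg hx,
          ← ENNReal.ofReal_coe_nnreal, ← ENNReal.ofReal_mul hx,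
          expNeg_ofReal (by positivity), ← ENNReal.ofReal_mul (by positivity),
          ENNReal.ofReal_coe_nnreal, e, ← ENNReal.ofReal_inv_of_pos hr,
          ← ENNReal.ofReal_mul (by positivity)]
        congr 1
        rw [← mul_assoc, inv_mul_cancel₀ hr.ne', one_mul, one_mul, one_mul,
          ← Real.exp_add]
        congr 1
        ring
    rw [lintegral_congr h1, lintegral_const_mul _ (by
      exact (measurable_exponentialPDFReal _).ennreal_ofReal),
      lintegral_exponentialPDF_eq_one hr, mul_one]

/-- The unit exponential law has mean one. -/
lemma lintegral_ofReal_expMeasure : ∫⁻ h, ENNReal.ofReal h ∂(expMeasure 1) = 1 := by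
  have := isProbabilityMeasure_expMeasure (r := 1) one_pos
  have h0 : 0 ≤ᵐ[expMeasure 1] fun h : ℝ => h := by
    have : ∀ᵐ h ∂(expMeasure 1), h ∉ Set.Iic (0 : ℝ) :=
      measure_eq_zero_iff_ae_notMem.1 expMeasure_one_Iic_zero
    filter_upwards [this] with h hh
    exact (not_le.1 hh).le
  -- Layer cake: the mean is the integral of the tail, and for rate one the tail coincides with the
  -- density.
  rw [lintegral_eq_lintegral_meas_lt _ h0 aemeasurable_id]
  have : ∀ t ∈ Set.Ioi (0 : ℝ), expMeasure 1 {a | t < a} = exponentialPDF 1 t := by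
    intro t ht
    rw [exponentialPDF_of_nonneg (le_of_lt ht)]
    rw [one_mul, one_mul]
    exact expMeasure_one_Ioi (le_of_lt ht)
  rw [setLIntegral_congr_fun measurableSet_Ioi this, ← withDensity_apply _ measurableSet_Ioi,
    ← expMeasure_one_eq, expMeasure_one_Ioi le_rfl]
  simp

end Exponential

end Laplace

/-! ### Poisson point processes: Campbell's formula and the Laplace functional -/

section Poisson

lemma pointCount_eq_tsum {Ω E : Type*} (X : ℕ → Ω → E) (B : Set E) (ω : Ω) :
    (pointCount X B ω : ℝ≥0∞) = ∑' i, B.indicator 1 (X i ω) := by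
  rw [pointCount, ← ENNReal.tsum_set_one, tsum_subtype {i | X i ω ∈ B} (fun _ => (1 : ℝ≥0∞))]
  rfl

variable {Ω : Type*} [MeasurableSpace Ω]

section PoissonPointProcess

variable {E : Type*} [MeasurableSpace E] {X : ℕ → Ω → E} {ν : Measure E} {μ : Measure Ω}

lemma IsPoissonPointProcess.measurable_toENNReal_pointCount (hX : IsPoissonPointProcess X ν μ)
    {B : Set E} (hB : MeasurableSet B) : Measurable fun ω => (pointCount X B ω : ℝ≥0∞) := by
  simp_rw [pointCount_eq_tsum]
  exact Measurable.tsum fun i => (measurable_one.indicator hB).comp (hX.measurable i)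

lemma IsPoissonPointProcess.measurable_pointCount (hX : IsPoissonPointProcess X ν μ)
    {B : Set E} (hB : MeasurableSet B) : Measurable (pointCount X B) := by
  refine measurable_to_countable' fun n => ?_
  have : pointCount X B ⁻¹' {n} = (fun ω => (pointCount X B ω : ℝ≥0∞)) ⁻¹' {(n : ℝ≥0∞)} := by
    ext ω; simp
  rw [this]
  exact hX.measurable_toENNReal_pointCount hB (measurableSet_singleton _)

/-- `count_law` speaks only of finite counts. The Poisson weights already sum to one, so no mass is
left for the value `⊤`; formally, an inequality between two probability measures forces equality. -/
lemma IsPoissonPointProcess.map_pointCount [IsProbabilityMeasure μ]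
    (hX : IsPoissonPointProcess X ν μ) {B : Set E} (hB : MeasurableSet B) (hν : ν B ≠ ∞) :
    μ.map (pointCount X B) = (poissonMeasure (ν B).toNNReal).map (Nat.cast : ℕ → ℕ∞) := by
  have hm := hX.measurable_pointCount hB
  have := Measure.isProbabilityMeasure_map (μ := μ) hm.aemeasurable
  symm
  refine Measure.eq_of_le_of_isProbabilityMeasure (Measure.le_iff.2 fun s hs => ?_)
  have hsing : poissonMeasure (ν B).toNNReal ((Nat.cast : ℕ → ℕ∞) ⁻¹' s) =
      ∑' n : ((Nat.cast : ℕ → ℕ∞) ⁻¹' s), poissonMeasure (ν B).toNNReal {(n : ℕ)} := by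
    rw [← measure_biUnion (f := fun n : ℕ => {n}) (Set.to_countable _) (fun i _ j _ hij => by
      simpa [Function.onFun] using hij) (fun _ _ => measurableSet_singleton _),
      Set.biUnion_of_singleton]
  rw [Measure.map_apply .of_discrete hs, hsing]
  calc _ = ∑' n : ((Nat.cast : ℕ → ℕ∞) ⁻¹' s), μ.map (pointCount X B) {((n : ℕ) : ℕ∞)} := by
        refine tsum_congr fun n => ?_
        rw [← hX.count_law B hB hν, Measure.map_apply hm (measurableSet_singleton _)]
        rfl
    _ = μ.map (pointCount X B) (⋃ n : ((Nat.cast : ℕ → ℕ∞) ⁻¹' s), {((n : ℕ) : ℕ∞)}) := by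
        rw [measure_iUnion _ (fun _ => measurableSet_singleton _)]
        intro i j hij
        simpa [Function.onFun, Subtype.ext_iff] using hij
    _ ≤ _ := by
        refine measure_mono (Set.iUnion_subset fun n => ?_)
        exact Set.singleton_subset_iff.2 n.2

lemma IsPoissonPointProcess.lintegral_pointCount [IsProbabilityMeasure μ]
    (hX : IsPoissonPointProcess X ν μ) {B : Set E} (hB : MeasurableSet B) (hν : ν B ≠ ∞)
    (g : ℕ∞ → ℝ≥0∞) :
    ∫⁻ ω, g (pointCount X B ω) ∂μ =
      ∑' n : ℕ, ENNReal.ofReal (Real.exp (-(ν B).toReal) * (ν B).toReal ^ n / n.factorial) * g n := by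
  rw [← lintegral_map (f := g) .of_discrete (hX.measurable_pointCount hB), hX.map_pointCount hB hν,
    lintegral_map .of_discrete .of_discrete, poissonMeasure, lintegral_sum_measure]
  refine tsum_congr fun n => ?_
  rw [lintegral_smul_measure, lintegral_dirac]
  rfl

lemma tsum_poisson_weights {r : ℝ} (hr : 0 ≤ r) :
    ∑' n : ℕ, ENNReal.ofReal (Real.exp (-r) * r ^ n / n.factorial) = 1 := by
  lift r to NNReal using hr
  rw [← ENNReal.ofReal_tsum_of_nonneg (fun n => by positivity)
    (hasSum_one_poissonMeasure r).summable, (hasSum_one_poissonMeasure r).tsum_eq,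
    ENNReal.ofReal_one]

lemma IsPoissonPointProcess.mean_pointCount [IsProbabilityMeasure μ]
    (hX : IsPoissonPointProcess X ν μ) {B : Set E} (hB : MeasurableSet B) (hν : ν B ≠ ∞) :
    ∫⁻ ω, (pointCount X B ω : ℝ≥0∞) ∂μ = ν B := by
  rw [hX.lintegral_pointCount hB hν (fun n => (n : ℝ≥0∞)), tsum_eq_zero_add' ENNReal.summable]
  have hr : 0 ≤ (ν B).toReal := ENNReal.toReal_nonneg
  -- With mean `r` and weights `p n`, one has `(n + 1) p (n + 1) = r p n`; the term `n = 0`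
  -- contributes nothing.
  have : ∀ n : ℕ, ENNReal.ofReal (Real.exp (-(ν B).toReal) * (ν B).toReal ^ (n + 1) /
      (n + 1).factorial) * (((n + 1 : ℕ) : ℕ∞) : ℝ≥0∞) = ENNReal.ofReal (ν B).toReal *
      ENNReal.ofReal (Real.exp (-(ν B).toReal) * (ν B).toReal ^ n / n.factorial) := by
    intro n
    rw [ENat.toENNReal_coe, ← ENNReal.ofReal_natCast (n + 1), ← ENNReal.ofReal_mul (by positivity),
      ← ENNReal.ofReal_mul hr, Nat.factorial_succ]
    congr 1
    push_cast
    field_simp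
    ring
  simp_rw [this]
  rw [ENNReal.tsum_mul_left, tsum_poisson_weights hr, ENNReal.ofReal_toReal hν]
  simp

/-- The intensity measure is the sum of the laws of the points. -/
lemma IsPoissonPointProcess.sum_map [IsProbabilityMeasure μ] [SigmaFinite ν]
    (hX : IsPoissonPointProcess X ν μ) : Measure.sum (fun i => μ.map (X i)) = ν := by
  have key : ∀ B, MeasurableSet B → ν B ≠ ∞ → Measure.sum (fun i => μ.map (X i)) B = ν B := by
    intro B hB hν
    rw [Measure.sum_apply _ hB, ← hX.mean_pointCount hB hν]
    simp_rw [pointCount_eq_tsum]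
    have hm : ∀ i, Measurable fun ω => B.indicator (1 : E → ℝ≥0∞) (X i ω) := fun i =>
      (measurable_one.indicator hB).comp (hX.measurable i)
    rw [lintegral_tsum fun i => (hm i).aemeasurable]
    refine tsum_congr fun i => ?_
    rw [Measure.map_apply (hX.measurable i) hB,
      ← lintegral_indicator_one (hX.measurable i hB)]
    rfl
  ext B hB
  -- By σ-finiteness, `B` is cut into disjoint pieces of finite intensity, on which the mean count
  -- is known.
  have hd : B = ⋃ n, B ∩ disjointed (spanningSets ν) n := by
    rw [← Set.inter_iUnion, iUnion_disjointed, iUnion_spanningSets, Set.inter_univ]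
  have hms : ∀ n, MeasurableSet (B ∩ disjointed (spanningSets ν) n) := fun n =>
    hB.inter (.disjointed (measurableSet_spanningSets ν) n)
  have hdisj : Pairwise (Function.onFun Disjoint fun n => B ∩ disjointed (spanningSets ν) n) :=
    fun i j hij => ((disjoint_disjointed (spanningSets ν)) hij).mono
      Set.inter_subset_right Set.inter_subset_right
  rw [hd, measure_iUnion hdisj hms, measure_iUnion hdisj hms]
  refine tsum_congr fun n => key _ (hms n) (ne_top_of_le_ne_top
    (measure_spanningSets_lt_top ν n).ne (measure_mono ?_))
  exact Set.inter_subset_right.trans (disjointed_subset _ _)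

/-- Campbell's formula. -/
lemma IsPoissonPointProcess.campbell [IsProbabilityMeasure μ] [SigmaFinite ν]
    (hX : IsPoissonPointProcess X ν μ) {f : E → ℝ≥0∞} (hf : Measurable f) :
    ∑' i, ∫⁻ ω, f (X i ω) ∂μ = ∫⁻ x, f x ∂ν := by
  rw [← hX.sum_map, lintegral_sum_measure]
  exact tsum_congr fun i => (lintegral_map hf (hX.measurable i)).symm

/-- Multiplying the Poisson weights of mean `r` by `exp (-c n)` gives those of mean `r exp (-c)`, up
to the factor `exp (-(1 - exp (-c)) r)`. -/
lemma IsPoissonPointProcess.laplace_pointCount [IsProbabilityMeasure μ]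
    (hX : IsPoissonPointProcess X ν μ) {B : Set E} (hB : MeasurableSet B) (hν : ν B ≠ ∞)
    {c : ℝ≥0∞} (hc : c ≠ ∞) :
    ∫⁻ ω, expNeg (c * pointCount X B ω) ∂μ = expNeg ((1 - expNeg c) * ν B) := by
  rw [hX.lintegral_pointCount hB hν (fun n => expNeg (c * n))]
  lift c to NNReal using hc
  set r := (ν B).toReal
  have hr : 0 ≤ r := ENNReal.toReal_nonneg
  have hq : 0 ≤ 1 - Real.exp (-c) := by simp
  have h1 : ∀ n : ℕ, ENNReal.ofReal (Real.exp (-r) * r ^ n / n.factorial) *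
      expNeg (c * ((n : ℕ∞) : ℝ≥0∞)) = ENNReal.ofReal (Real.exp (-(1 - Real.exp (-c)) * r)) *
      ENNReal.ofReal (Real.exp (-(r * Real.exp (-c))) * (r * Real.exp (-c)) ^ n /
        n.factorial) := by
    intro n
    rw [ENat.toENNReal_coe, ← ENNReal.ofReal_natCast n, ← ENNReal.ofReal_coe_nnreal,
      ← ENNReal.ofReal_mul c.coe_nonneg, expNeg_ofReal (by positivity),
      ← ENNReal.ofReal_mul (by positivity), ← ENNReal.ofReal_mul (by positivity)]
    congr 1
    rw [mul_pow, ← Real.exp_nat_mul, show -r = -(1 - Real.exp (-c)) * r + -(r * Real.exp (-c)) by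
      ring, Real.exp_add, show -((c : ℝ) * n) = n * -c by ring]
    ring
  simp_rw [h1]
  rw [ENNReal.tsum_mul_left, tsum_poisson_weights (by positivity), mul_one,
    ← ENNReal.ofReal_coe_nnreal, expNeg_ofReal c.coe_nonneg, ← ENNReal.ofReal_one,
    ← ENNReal.ofReal_sub _ (Real.exp_pos _).le, ← ENNReal.ofReal_toReal hν,
    ← ENNReal.ofReal_mul hq, expNeg_ofReal (mul_nonneg hq hr), neg_mul]

/-- The level sets are disjoint, so their counts are independent and the expectation factors over
the levels. The level `0` is left out: it contributes nothing and may have infinite intensity. -/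
lemma IsPoissonPointProcess.laplace_simpleFunc [IsProbabilityMeasure μ]
    (hX : IsPoissonPointProcess X ν μ) (f : SimpleFunc E ℝ≥0∞) (hf : ∀ x, f x ≠ ∞)
    (hν : ∀ c, c ≠ 0 → ν (f ⁻¹' {c}) ≠ ∞) :
    ∫⁻ ω, expNeg (∑' i, f (X i ω)) ∂μ = expNeg (∫⁻ x, (1 - expNeg (f x)) ∂ν) := by
  classical
  set s : Finset ℝ≥0∞ := f.range.filter (· ≠ 0) with hs
  have hs0 : ∀ c ∈ s, c ≠ 0 := fun c hc => (Finset.mem_filter.1 hc).2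
  have hs_finite : ∀ c ∈ s, c ≠ ∞ := by
    intro c hc
    obtain ⟨x, rfl⟩ := SimpleFunc.mem_range.1 (Finset.mem_filter.1 hc).1
    exact hf x
  have hmeas : ∀ c, MeasurableSet (f ⁻¹' {c}) := fun c => f.measurableSet_fiber c
  -- Used for the identity, to rewrite the sum over the points, and for `1 - expNeg`, to rewrite the
  -- exponent.
  have hdec : ∀ (g : ℝ≥0∞ → ℝ≥0∞), g 0 = 0 → ∀ x,
      g (f x) = ∑ c ∈ s, g c * (f ⁻¹' {c}).indicator 1 x := by
    intro g hg x
    by_cases hx : f x = 0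
    · rw [hx, hg, Finset.sum_eq_zero]
      intro c hc
      rw [Set.indicator_of_notMem, mul_zero]
      simpa [hx] using (hs0 c hc).symm
    · rw [Finset.sum_eq_single_of_mem (f x)
        (Finset.mem_filter.2 ⟨SimpleFunc.mem_range_self f x, hx⟩)]
      · simp
      · intro c _ hc
        rw [Set.indicator_of_notMem, mul_zero]
        simpa using hc.symm
  have h1 : ∀ ω, ∑' i, f (X i ω) = ∑ c ∈ s, c * pointCount X (f ⁻¹' {c}) ω := by
    intro ω
    simp_rw [pointCount_eq_tsum, ← ENNReal.tsum_mul_left]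
    rw [← Summable.tsum_finsetSum fun _ _ => ENNReal.summable]
    exact tsum_congr fun i => hdec id rfl (X i ω)
  have h2 : ∫⁻ x, (1 - expNeg (f x)) ∂ν = ∑ c ∈ s, (1 - expNeg c) * ν (f ⁻¹' {c}) := by
    simp_rw [hdec (fun c => 1 - expNeg c) (by simp [expNeg_zero])]
    rw [lintegral_finsetSum _ fun c _ => (measurable_one.indicator (hmeas c)).const_mul _]
    refine Finset.sum_congr rfl fun c _ => ?_
    rw [lintegral_const_mul _ (measurable_one.indicator (hmeas c)),
      lintegral_indicator_one (hmeas c)]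
  set e := s.equivFin.symm
  have hsum : ∀ F : ℝ≥0∞ → ℝ≥0∞, ∑ c ∈ s, F c = ∑ j : Fin s.card, F (e j) := by
    intro F
    rw [← Finset.sum_coe_sort, ← e.sum_comp]
  have hind := hX.count_indep s.card (fun j => f ⁻¹' {(e j : ℝ≥0∞)}) (fun j => hmeas _) (by
    intro j k hjk
    refine Set.disjoint_left.2 fun x hx hx' => hjk (e.injective (Subtype.ext ?_))
    exact (Set.mem_singleton_iff.1 hx).symm.trans (Set.mem_singleton_iff.1 hx'))
  have hind2 := hind.comp (fun j n => expNeg ((e j : ℝ≥0∞) * n)) (fun j => .of_discrete)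
  simp_rw [h1]
  rw [h2, hsum, expNeg_sum]
  simp_rw [hsum, expNeg_sum]
  have := lintegral_finset_prod_of_iIndepFun (fun j => ?_) hind2 Finset.univ
  · refine Eq.trans this (Finset.prod_congr rfl fun j _ => ?_)
    exact hX.laplace_pointCount (hmeas _) (hν _ (hs0 _ (e j).2)) (hs_finite _ (e j).2)
  · exact Measurable.comp .of_discrete (hX.measurable_pointCount (hmeas _))

/-- The Laplace functional of a Poisson point process. -/
lemma IsPoissonPointProcess.laplace [IsProbabilityMeasure μ] [SigmaFinite ν]
    (hX : IsPoissonPointProcess X ν μ) {f : E → ℝ≥0∞} (hf : Measurable f) :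
    ∫⁻ ω, expNeg (∑' i, f (X i ω)) ∂μ = expNeg (∫⁻ x, (1 - expNeg (f x)) ∂ν) := by
  -- Restricting the simple approximations to the spanning sets gives every nonzero level finite
  -- intensity, as `laplace_simpleFunc` demands, and keeps the sequence increasing to `f`.
  set g : ℕ → SimpleFunc E ℝ≥0∞ := fun n =>
    (SimpleFunc.eapprox f n).restrict (spanningSets ν n) with hg
  have hgval : ∀ n x, g n x = (spanningSets ν n).indicator (SimpleFunc.eapprox f n) x :=
    fun n x => SimpleFunc.restrict_apply _ (measurableSet_spanningSets ν n) x
  have hmono : ∀ x, Monotone fun n => g n x := by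
    intro x n m hnm
    simp only [hgval]
    calc _ ≤ (spanningSets ν n).indicator (SimpleFunc.eapprox f m) x :=
          Set.indicator_le_indicator (SimpleFunc.monotone_eapprox f hnm x)
      _ ≤ _ := Set.indicator_le_indicator_of_subset (monotone_spanningSets ν hnm)
          (fun _ => zero_le) x
  have hsup : ∀ x, Filter.Tendsto (fun n => g n x) Filter.atTop (nhds (f x)) := by
    intro x
    have h1 : Filter.Tendsto (fun n => SimpleFunc.eapprox f n x) Filter.atTop (nhds (f x)) := by
      rw [← SimpleFunc.iSup_eapprox_apply hf x]
      exact tendsto_atTop_iSup fun n m h => SimpleFunc.monotone_eapprox f h x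
    refine h1.congr' ?_
    filter_upwards [Filter.eventually_ge_atTop (spanningSetsIndex ν x)] with n hn
    rw [hgval, Set.indicator_of_mem (mem_spanningSets_of_index_le ν x hn)]
  have hlap : ∀ n, ∫⁻ ω, expNeg (∑' i, g n (X i ω)) ∂μ = expNeg (∫⁻ x, (1 - expNeg (g n x)) ∂ν) := by
    intro n
    refine hX.laplace_simpleFunc (g n) (fun x => ?_) (fun c hc => ?_)
    · rw [hgval]
      by_cases hx : x ∈ spanningSets ν n
      · rw [Set.indicator_of_mem hx]
        exact (SimpleFunc.eapprox_lt_top f n x).ne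
      · simp [hx]
    · refine ne_top_of_le_ne_top (measure_spanningSets_lt_top ν n).ne (measure_mono fun x hx => ?_)
      by_contra hx'
      apply hc
      rw [← Set.mem_singleton_iff.1 hx, hgval, Set.indicator_of_notMem hx']
  have hL : Filter.Tendsto (fun n => ∫⁻ ω, expNeg (∑' i, g n (X i ω)) ∂μ) Filter.atTop
      (nhds (∫⁻ ω, expNeg (∑' i, f (X i ω)) ∂μ)) := by
    refine tendsto_lintegral_of_le_one (fun n => measurable_expNeg.comp
      (Measurable.tsum fun i => (g n).measurable.comp (hX.measurable i)))
      (fun n ω => expNeg_le_one _) (fun ω => (continuous_expNeg.tendsto _).comp ?_)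
    -- A series is an integral against counting measure, so monotone convergence applies to it.
    simp_rw [← lintegral_count]
    exact lintegral_tendsto_of_tendsto_of_monotone (fun n => .of_discrete)
      (.of_forall fun i => hmono _) (.of_forall fun i => hsup _)
  have hR : Filter.Tendsto (fun n => expNeg (∫⁻ x, (1 - expNeg (g n x)) ∂ν)) Filter.atTop
      (nhds (expNeg (∫⁻ x, (1 - expNeg (f x)) ∂ν))) := by
    refine (continuous_expNeg.tendsto _).comp (lintegral_tendsto_of_tendsto_of_monotone
      (fun n => (measurable_const.sub (measurable_expNeg.comp (g n).measurable)).aemeasurable)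
      (.of_forall fun x n m h => tsub_le_tsub_left (antitone_expNeg (hmono x h)) 1)
      (.of_forall fun x => ?_))
    exact ENNReal.Tendsto.sub tendsto_const_nhds ((continuous_expNeg.tendsto _).comp (hsup x))
      (.inl ENNReal.one_ne_top)
  simp_rw [hlap] at hL
  exact tendsto_nhds_unique hL hR

end PoissonPointProcess

end Poisson

/-! ### The access event: averaging over fading, then over positions -/

section Model

lemma measurable_tsum_ofReal_mul {Ω : Type*} {m : MeasurableSpace Ω} {h : ℕ → Ω → ℝ}
    (hm : ∀ j, Measurable (h j)) (a : ℕ → ℝ≥0∞) :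
    Measurable fun ω => ∑' j, ENNReal.ofReal (h j ω) * a j :=
  Measurable.tsum fun j => (hm j).ennreal_ofReal.mul_const _

variable {Ω : Type*} [MeasurableSpace Ω]

/-- Laplace transform of a weighted sum of independent unit exponential variables. -/
lemma laplace_exponential_sum {μ : Measure Ω} [IsProbabilityMeasure μ] {h : ℕ → Ω → ℝ}
    (hm : ∀ j, Measurable (h j)) (hlaw : ∀ j, HasLaw (h j) (expMeasure 1) μ)
    (hind : iIndepFun h μ) (a : ℕ → ℝ≥0∞) :
    ∫⁻ ω, expNeg (∑' j, ENNReal.ofReal (h j ω) * a j) ∂μ =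
      expNeg (∑' j, negLog (1 + a j)⁻¹) := by
  have hg : ∀ j, Measurable fun x : ℝ => expNeg (ENNReal.ofReal x * a j) := fun j =>
    measurable_expNeg.comp (by fun_prop)
  have hgm : ∀ j, Measurable fun ω => expNeg (ENNReal.ofReal (h j ω) * a j) := fun j =>
    (hg j).comp (hm j)
  have hL : Filter.Tendsto
      (fun n => ∫⁻ ω, ∏ j ∈ Finset.range n, expNeg (ENNReal.ofReal (h j ω) * a j) ∂μ)
      Filter.atTop (nhds (∫⁻ ω, expNeg (∑' j, ENNReal.ofReal (h j ω) * a j) ∂μ)) :=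
    tendsto_lintegral_of_le_one (fun n => Finset.measurable_fun_prod _ fun j _ => hgm j)
      (fun n ω => Finset.prod_le_one' fun j _ => expNeg_le_one _)
      (fun ω => expNeg_tsum_tendsto _)
  have hfin : ∀ n, ∫⁻ ω, ∏ j ∈ Finset.range n, expNeg (ENNReal.ofReal (h j ω) * a j) ∂μ =
      ∏ j ∈ Finset.range n, expNeg (negLog (1 + a j)⁻¹) := by
    intro n
    refine (lintegral_finset_prod_of_iIndepFun hgm (hind.comp _ hg) _).trans
      (Finset.prod_congr rfl fun j _ => ?_)
    rw [expNeg_negLog (ENNReal.inv_le_one.2 le_self_add), ← lintegral_expNeg_mul_expMeasure,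
      ← (hlaw j).map_eq, lintegral_map (hg j) (hm j)]
  simp_rw [hfin] at hL
  exact tendsto_nhds_unique hL (expNeg_tsum_tendsto _)

namespace EmptyBallModel

variable {μ : Measure Ω} {lam R : ℝ}

/-- The links from the primary transmitters, the nearest one first. -/
def primaryLink : ℕ → Link
  | 0 => Link.nearest
  | i + 1 => Link.other i

lemma primaryLink_injective : Function.Injective primaryLink := by
  rintro (_ | i) (_ | j) h <;> simp_all [primaryLink]

lemma primaryLink_ne_desired (j : ℕ) : primaryLink j ≠ Link.desired := by
  cases j <;> simp [primaryLink]

/-- The desired gain exceeds a weighted sum of the interfering gains. -/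
lemma measure_weighted_lt_desired [IsProbabilityMeasure μ] (M : EmptyBallModel μ lam R)
    (a₀ : ℝ≥0∞) (a : ℕ → ℝ≥0∞) :
    μ {ω | ENNReal.ofReal (M.fading Link.nearest ω) * a₀ +
        ∑' i, ENNReal.ofReal (M.fading (Link.other i) ω) * a i <
          ENNReal.ofReal (M.fading Link.desired ω)} =
      (1 + a₀)⁻¹ * expNeg (∑' i, negLog (1 + a i)⁻¹) := by
  set A : ℕ → ℝ≥0∞ := fun j => Nat.casesOn j a₀ a with hA
  set Y : Ω → ℝ≥0∞ := fun ω => ∑' j, ENNReal.ofReal (M.fading (primaryLink j) ω) * A j with hY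
  have hsplit : ∀ f : ℕ → ℝ≥0∞, ∑' j, f j = f 0 + ∑' i, f (i + 1) := fun f =>
    tsum_eq_zero_add' ENNReal.summable
  -- `Y` is measurable for the σ-algebra of all the other gains, which is independent of that of the
  -- desired gain.
  have hYm : Measurable[⨆ l ∈ ({Link.desired}ᶜ : Set Link),
      MeasurableSpace.comap (M.fading l) inferInstance] Y := by
    refine @measurable_tsum_ofReal_mul Ω _ _ (fun j => ?_) A
    refine Measurable.mono (comap_measurable (M.fading (primaryLink j))) ?_ le_rfl
    exact le_iSup₂_of_le (f := fun l (_ : l ∈ ({Link.desired}ᶜ : Set Link)) =>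
      MeasurableSpace.comap (M.fading l) inferInstance) (primaryLink j)
      (primaryLink_ne_desired j) le_rfl
  have hle : ∀ l, MeasurableSpace.comap (M.fading l) inferInstance ≤ ‹MeasurableSpace Ω› :=
    fun l => (M.fading_measurable l).comap_le
  have hYm' : Measurable Y := hYm.mono (iSup₂_le fun l _ => hle l) le_rfl
  have hind : IndepFun Y (M.fading Link.desired) μ := by
    have h := indep_iSup_of_disjoint hle ((iIndepFun_iff_iIndep _ _ _).1 M.fading_indep)
      (disjoint_compl_left : Disjoint ({Link.desired}ᶜ : Set Link) {Link.desired})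
    rw [iSup_singleton] at h
    exact indep_of_indep_of_le_left h hYm.comap_le
  have hset : {ω | ENNReal.ofReal (M.fading Link.nearest ω) * a₀ +
        ∑' i, ENNReal.ofReal (M.fading (Link.other i) ω) * a i <
          ENNReal.ofReal (M.fading Link.desired ω)} =
      {ω | Y ω < ENNReal.ofReal (M.fading Link.desired ω)} := by
    ext ω
    change _ ↔ ∑' j, ENNReal.ofReal (M.fading (primaryLink j) ω) * A j < _
    rw [hsplit fun j => ENNReal.ofReal (M.fading (primaryLink j) ω) * A j]
    rfl
  have hΦ : MeasurableSet {p : ℝ≥0∞ × ℝ | p.1 < ENNReal.ofReal p.2} :=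
    measurableSet_lt (by fun_prop) (by fun_prop)
  have hmeas : MeasurableSet {ω | Y ω < ENNReal.ofReal (M.fading Link.desired ω)} :=
    measurableSet_lt hYm' (M.fading_measurable _).ennreal_ofReal
  have h1 := lintegral_of_indepFun hYm' (M.fading_measurable Link.desired) hind
    (Φ := fun y h => Set.indicator {p : ℝ≥0∞ × ℝ | p.1 < ENNReal.ofReal p.2} 1 (y, h))
    (measurable_one.indicator hΦ)
  have h2 : ∀ y : ℝ≥0∞, ∫⁻ ω', Set.indicator {p : ℝ≥0∞ × ℝ | p.1 < ENNReal.ofReal p.2} 1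
      (y, M.fading Link.desired ω') ∂μ = expNeg y := by
    intro y
    have hy : MeasurableSet {h : ℝ | y < ENNReal.ofReal h} :=
      measurableSet_lt measurable_const (by fun_prop)
    rw [← expMeasure_one_lt_ofReal, ← (M.fading_law Link.desired).map_eq,
      Measure.map_apply (M.fading_measurable _) hy,
      ← lintegral_indicator_one (M.fading_measurable _ hy)]
    rfl
  have h3 : ∫⁻ ω, Set.indicator {p : ℝ≥0∞ × ℝ | p.1 < ENNReal.ofReal p.2} 1
      (Y ω, M.fading Link.desired ω) ∂μ =
        μ {ω | Y ω < ENNReal.ofReal (M.fading Link.desired ω)} := by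
    rw [← lintegral_indicator_one hmeas]
    rfl
  simp_rw [h2] at h1
  rw [hset, ← h3, h1, laplace_exponential_sum (fun j => M.fading_measurable _)
    (fun j => M.fading_law _) (M.fading_indep.precomp primaryLink_injective), hsplit, expNeg_add,
    expNeg_negLog (ENNReal.inv_le_one.2 le_self_add)]
  rfl

lemma measurable_nearestPos (M : EmptyBallModel μ lam R) : Measurable M.nearestPos := by
  have := M.angle_measurable
  unfold nearestPos
  fun_prop

lemma sigmaFinite_intensity (lam R : ℝ) : SigmaFinite
    (ENNReal.ofReal lam • (volume : Measure ℂ).restrict (Metric.closedBall 0 R)ᶜ) :=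
  inferInstanceAs (SigmaFinite
    (lam.toNNReal • (volume : Measure ℂ).restrict (Metric.closedBall 0 R)ᶜ))

/-- The path gain from `x` to `z`. -/
lemma measurable_pathGain (α : ℝ) (z : ℂ) : Measurable fun x : ℂ => ‖x - z‖ₑ ^ (-α) := by
  fun_prop

/-- Mean of the aggregate interference. -/
lemma lintegral_interference [IsProbabilityMeasure μ] (M : EmptyBallModel μ lam R) (P₁ α : ℝ)
    (z : ℂ) :
    ∫⁻ ω, M.interference P₁ α z ω ∂μ = ENNReal.ofReal P₁ *
      (∫⁻ ω, ‖M.nearestPos ω - z‖ₑ ^ (-α) ∂μ + ENNReal.ofReal lam *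
        ∫⁻ x in (Metric.closedBall (0 : ℂ) R)ᶜ, ‖x - z‖ₑ ^ (-α)) := by
  have := sigmaFinite_intensity lam R
  have hg := measurable_pathGain α z
  have hf : ∀ l, Measurable fun ω => ENNReal.ofReal (M.fading l ω) := fun l =>
    (M.fading_measurable l).ennreal_ofReal
  have hmean : ∀ l, ∫⁻ ω, ENNReal.ofReal (M.fading l ω) ∂μ = 1 := fun l => by
    rw [← lintegral_ofReal_expMeasure, ← (M.fading_law l).map_eq,
      lintegral_map ENNReal.measurable_ofReal (M.fading_measurable l)]
  -- Each gain is independent of the geometry and has mean one, so it drops out of the expectation.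
  have hprod : ∀ l (φ : ℝ × (ℕ → ℂ) → ℝ≥0∞), Measurable φ →
      ∫⁻ ω, ENNReal.ofReal (M.fading l ω) * φ (M.angle ω, fun i => M.pos i ω) ∂μ =
        ∫⁻ ω, φ (M.angle ω, fun i => M.pos i ω) ∂μ := by
    intro l φ hφ
    have hind := (M.indep_fading.comp (ψ := fun h : Link → ℝ => ENNReal.ofReal (h l)) hφ
      (by fun_prop)).symm
    have hφm : Measurable fun ω => φ (M.angle ω, fun i => M.pos i ω) :=
      hφ.comp (M.angle_measurable.prodMk (measurable_pi_lambda _ M.pos_poisson.measurable))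
    rw [lintegral_mul_eq_lintegral_mul_lintegral_of_indepFun'' (hf l).aemeasurable
      hφm.aemeasurable hind, hmean, one_mul]
  have hnear : Measurable fun ω => ‖M.nearestPos ω - z‖ₑ ^ (-α) := hg.comp M.measurable_nearestPos
  have hpos : ∀ i, Measurable fun ω => ‖M.pos i ω - z‖ₑ ^ (-α) := fun i =>
    hg.comp (M.pos_poisson.measurable i)
  have h1 : Measurable fun ω =>
      ENNReal.ofReal (M.fading Link.nearest ω) * ‖M.nearestPos ω - z‖ₑ ^ (-α) := (hf _).mul hnear
  have h2 : ∀ i, Measurable fun ω =>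
      ENNReal.ofReal (M.fading (Link.other i) ω) * ‖M.pos i ω - z‖ₑ ^ (-α) := fun i =>
    (hf _).mul (hpos i)
  unfold interference
  rw [lintegral_const_mul' _ _ ENNReal.ofReal_ne_top, lintegral_add_left h1,
    lintegral_tsum fun i => (h2 i).aemeasurable]
  congr 2
  · exact hprod Link.nearest (fun p => ‖R * Complex.exp (p.1 * Complex.I) - z‖ₑ ^ (-α))
      (by fun_prop)
  · rw [← smul_eq_mul, ← lintegral_smul_measure, ← M.pos_poisson.campbell hg]
    exact tsum_congr fun i => hprod (Link.other i) (fun p => ‖p.2 i - z‖ₑ ^ (-α)) (by fun_prop)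

/-- The signal-to-interference condition in terms of the fading gains. -/
lemma lt_sir_iff (M : EmptyBallModel μ lam R) {P₁ P₂ α θ : ℝ} (hP₂ : 0 < P₂)
    (hθ : 0 < θ) {z : ℂ} (hz : z ≠ 0) (ω : Ω) :
    ENNReal.ofReal θ < M.sir P₁ P₂ α z ω ↔
      ENNReal.ofReal (M.fading Link.nearest ω) *
          (ENNReal.ofReal (P₁ * θ * ‖z‖ ^ α / P₂) * ‖M.nearestPos ω - z‖ₑ ^ (-α)) +
        ∑' i, ENNReal.ofReal (M.fading (Link.other i) ω) *
          (ENNReal.ofReal (P₁ * θ * ‖z‖ ^ α / P₂) * ‖M.pos i ω - z‖ₑ ^ (-α)) <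
      ENNReal.ofReal (M.fading Link.desired ω) := by
  have hz' : 0 < ‖z‖ := norm_pos_iff.2 hz
  set S := ENNReal.ofReal P₂ * ENNReal.ofReal (M.fading Link.desired ω) * ‖z‖ₑ ^ (-α) with hS
  set J := M.interference P₁ α z ω with hJ
  have hzr : ‖z‖ₑ ^ (-α) = ENNReal.ofReal (‖z‖ ^ (-α)) := by
    rw [← ofReal_norm, ENNReal.ofReal_rpow_of_pos hz']
  have hS_finite : S ≠ ∞ := by
    rw [hS, hzr]
    exact ENNReal.mul_ne_top (ENNReal.mul_ne_top ENNReal.ofReal_ne_top ENNReal.ofReal_ne_top)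
      ENNReal.ofReal_ne_top
  have hθ0 : ENNReal.ofReal θ ≠ 0 := by simpa using hθ
  -- The equivalence survives `J = 0` because in `[0, ∞]` the quotient `S / 0` is `∞` for `S ≠ 0`,
  -- while `0 / 0 = 0`.
  have step1 : ENNReal.ofReal θ < S / J ↔ ENNReal.ofReal θ * J < S := by
    rcases eq_or_ne J 0 with h0 | h0
    · rw [h0, mul_zero]
      rcases eq_or_ne S 0 with hS0 | hS0
      · simp [hS0]
      · simp [ENNReal.div_zero hS0, pos_iff_ne_zero, hS0]
    · exact ENNReal.lt_div_iff_mul_lt (.inl h0) (.inr hθ0)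
  -- The factor that strips power and path loss from the signal and leaves the bare desired gain.
  set k : ℝ≥0∞ := ENNReal.ofReal (‖z‖ ^ α / P₂) with hk
  have hk0 : k ≠ 0 := by rw [hk]; simpa using (by positivity : 0 < ‖z‖ ^ α / P₂)
  have hkS : k * S = ENNReal.ofReal (M.fading Link.desired ω) := by
    rw [hS, hzr, hk, mul_comm (ENNReal.ofReal P₂), mul_assoc, ← ENNReal.ofReal_mul hP₂.le,
      mul_left_comm, ← ENNReal.ofReal_mul (by positivity), Real.rpow_neg hz'.le]
    have : ‖z‖ ^ α / P₂ * (P₂ * (‖z‖ ^ α)⁻¹) = 1 := by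
      have : ‖z‖ ^ α ≠ 0 := by positivity
      field_simp
    rw [this, ENNReal.ofReal_one, mul_one]
  have hc : k * ENNReal.ofReal θ * ENNReal.ofReal P₁ =
      ENNReal.ofReal (P₁ * θ * ‖z‖ ^ α / P₂) := by
    rw [hk, ← ENNReal.ofReal_mul (by positivity), ← ENNReal.ofReal_mul (by positivity)]
    congr 1
    ring
  have hkJ : k * (ENNReal.ofReal θ * J) = ENNReal.ofReal (M.fading Link.nearest ω) *
          (ENNReal.ofReal (P₁ * θ * ‖z‖ ^ α / P₂) * ‖M.nearestPos ω - z‖ₑ ^ (-α)) +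
        ∑' i, ENNReal.ofReal (M.fading (Link.other i) ω) *
          (ENNReal.ofReal (P₁ * θ * ‖z‖ ^ α / P₂) * ‖M.pos i ω - z‖ₑ ^ (-α)) := by
    rw [hJ, interference, ← mul_assoc, ← mul_assoc, hc, mul_add, ← ENNReal.tsum_mul_left]
    congr 1
    · ring
    · exact tsum_congr fun i => by ring
  rw [← hkJ, ← hkS, ENNReal.mul_lt_mul_iff_right hk0 ENNReal.ofReal_ne_top, ← step1]
  rfl

/-- The access probability as a product of the contributions of the nearest primary transmitter
and of the other ones. -/
lemma measure_lt_sir [IsProbabilityMeasure μ] (M : EmptyBallModel μ lam R) {P₁ P₂ α θ : ℝ}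
    (hP₂ : 0 < P₂) (hθ : 0 < θ) {z : ℂ} (hz : z ≠ 0) :
    μ {ω | ENNReal.ofReal θ < M.sir P₁ P₂ α z ω} =
      (∫⁻ ω, (1 + ENNReal.ofReal (P₁ * θ * ‖z‖ ^ α / P₂) * ‖M.nearestPos ω - z‖ₑ ^ (-α))⁻¹ ∂μ) *
      expNeg (ENNReal.ofReal lam * ∫⁻ x in (Metric.closedBall (0 : ℂ) R)ᶜ,
        (1 - (1 + ENNReal.ofReal (P₁ * θ * ‖z‖ ^ α / P₂) * ‖x - z‖ₑ ^ (-α))⁻¹)) := by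
  have := sigmaFinite_intensity lam R
  set c := ENNReal.ofReal (P₁ * θ * ‖z‖ ^ α / P₂) with hc
  set S : Set ((ℝ × (ℕ → ℂ)) × (Link → ℝ)) := {p | ENNReal.ofReal (p.2 Link.nearest) *
      (c * ‖R * Complex.exp (p.1.1 * Complex.I) - z‖ₑ ^ (-α)) +
    ∑' i, ENNReal.ofReal (p.2 (Link.other i)) * (c * ‖p.1.2 i - z‖ₑ ^ (-α)) <
      ENNReal.ofReal (p.2 Link.desired)}
  have hSm : MeasurableSet S := by
    refine measurableSet_lt (Measurable.add ?_ (Measurable.tsum fun i => ?_)) ?_ <;> fun_prop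
  have hpm : Measurable fun ω => (M.angle ω, fun i => M.pos i ω) :=
    M.angle_measurable.prodMk (measurable_pi_lambda _ M.pos_poisson.measurable)
  have hfm : Measurable fun ω l => M.fading l ω := measurable_pi_lambda _ M.fading_measurable
  have h1 := lintegral_of_indepFun hpm hfm M.indep_fading
    (Φ := fun p h => S.indicator 1 (p, h)) (measurable_one.indicator hSm)
  have hset : {ω | ENNReal.ofReal θ < M.sir P₁ P₂ α z ω} =
      (fun ω => ((M.angle ω, fun i => M.pos i ω), fun l => M.fading l ω)) ⁻¹' S := by
    ext ω
    exact M.lt_sir_iff hP₂ hθ hz ω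
  -- The positions are frozen at `p`, and only the gains are averaged.
  have h2 : ∀ p : ℝ × (ℕ → ℂ), ∫⁻ ω', S.indicator 1 (p, fun l => M.fading l ω') ∂μ =
      (1 + c * ‖R * Complex.exp (p.1 * Complex.I) - z‖ₑ ^ (-α))⁻¹ *
        expNeg (∑' i, negLog (1 + c * ‖p.2 i - z‖ₑ ^ (-α))⁻¹) := by
    intro p
    rw [← M.measure_weighted_lt_desired, ← lintegral_indicator_one]
    · rfl
    · exact (measurable_prodMk_left.comp hfm) hSm
  have h3 : ∫⁻ ω, S.indicator 1 ((M.angle ω, fun i => M.pos i ω), fun l => M.fading l ω) ∂μ =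
      μ {ω | ENNReal.ofReal θ < M.sir P₁ P₂ α z ω} := by
    rw [hset, ← lintegral_indicator_one ((hpm.prodMk hfm) hSm)]
    rfl
  have hum : Measurable fun x : ℂ => (1 + c * ‖x - z‖ₑ ^ (-α))⁻¹ := by fun_prop
  -- The Laplace functional is applied to `negLog` of the fading factor, so that `expNeg` returns
  -- the factor itself.
  have h4 : ∫⁻ ω, expNeg (∑' i, negLog (1 + c * ‖M.pos i ω - z‖ₑ ^ (-α))⁻¹) ∂μ =
      expNeg (ENNReal.ofReal lam * ∫⁻ x in (Metric.closedBall (0 : ℂ) R)ᶜ,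
        (1 - (1 + c * ‖x - z‖ₑ ^ (-α))⁻¹)) := by
    refine (M.pos_poisson.laplace (measurable_negLog.comp hum)).trans ?_
    rw [lintegral_smul_measure, smul_eq_mul]
    simp_rw [Function.comp_apply, expNeg_negLog (ENNReal.inv_le_one.2 le_self_add)]
  have hA : Measurable fun t : ℝ => (1 + c * ‖R * Complex.exp (t * Complex.I) - z‖ₑ ^ (-α))⁻¹ := by
    fun_prop
  have hB : Measurable fun p : ℕ → ℂ => expNeg (∑' i, negLog (1 + c * ‖p i - z‖ₑ ^ (-α))⁻¹) :=
    measurable_expNeg.comp (Measurable.tsum fun i =>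
      (measurable_negLog.comp hum).comp (measurable_pi_apply i))
  rw [← h3, h1]
  simp_rw [h2]
  rw [← h4]
  exact lintegral_mul_eq_lintegral_mul_lintegral_of_indepFun''
    (hA.comp M.angle_measurable).aemeasurable
    (hB.comp (measurable_pi_lambda _ M.pos_poisson.measurable)).aemeasurable
    (M.indep_angle_pos.comp hA hB)

end EmptyBallModel

end Model

/-! ### Polar integration over the exterior of a ball -/

section Geometry

/-- Integration over the plane in polar coordinates. -/
lemma lintegral_complex_polar {f : ℂ → ℝ≥0∞} (hf : Measurable f) :
    ∫⁻ w, f w = ∫⁻ r in Set.Ioi (0 : ℝ), ENNReal.ofReal r *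
      ∫⁻ t in Set.Ioo (-Real.pi) Real.pi, f (r * Complex.exp (t * Complex.I)) := by
  have hm : Measurable fun p : ℝ × ℝ => f (p.1 * Complex.exp (p.2 * Complex.I)) :=
    hf.comp (by fun_prop)
  rw [← Complex.lintegral_comp_polarCoord_symm, polarCoord_target, Measure.volume_eq_prod,
    ← Measure.prod_restrict]
  have : ∀ p : ℝ × ℝ, ENNReal.ofReal p.1 • f (Complex.polarCoord.symm p) =
      ENNReal.ofReal p.1 * f (p.1 * Complex.exp (p.2 * Complex.I)) := by
    intro p
    rw [Complex.polarCoord_symm_apply, Complex.exp_mul_I, smul_eq_mul]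
    push_cast
    rfl
  simp_rw [this]
  have hm' : Measurable fun p : ℝ × ℝ =>
      ENNReal.ofReal p.1 * f (p.1 * Complex.exp (p.2 * Complex.I)) :=
    measurable_fst.ennreal_ofReal.mul hm
  rw [lintegral_prod _ hm'.aemeasurable]
  refine lintegral_congr fun r => lintegral_const_mul' _ _ ENNReal.ofReal_ne_top

/-- No bound on `c` is needed: the clamped `arccos` is `π` for `c < -1`, where every angle
qualifies, and `0` for `c ≥ 1`, where none does. This gives circles outside or inside the ball the
same formula as partial arcs. -/
lemma abs_lt_arccos_iff {c t : ℝ} (ht : |t| < Real.pi) : |t| < Real.arccos c ↔ c < Real.cos t := by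
  rw [← Real.cos_abs]
  constructor
  · intro h
    rcases lt_or_ge c (-1) with hc | hc
    · exact hc.trans_le (Real.neg_one_le_cos _)
    rcases le_or_gt 1 c with hc' | hc'
    · rw [Real.arccos_eq_zero.2 hc'] at h
      exact absurd h (not_lt.2 (abs_nonneg t))
    · exact (Real.cos_arccos hc hc'.le).symm.trans_lt
        (Real.cos_lt_cos_of_nonneg_of_le_pi (abs_nonneg t) (Real.arccos_le_pi c) h)
  · intro h
    rcases lt_or_ge c (-1) with hc | hc
    · rwa [Real.arccos_eq_pi.2 hc.le]
    · rw [← Real.arccos_cos (abs_nonneg t) ht.le]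
      exact Real.arccos_lt_arccos hc h (Real.cos_le_one _)

lemma norm_mul_exp_add_sq (r d t : ℝ) :
    ‖(r : ℂ) * Complex.exp (t * Complex.I) + d‖ ^ 2 = r ^ 2 + d ^ 2 + 2 * d * r * Real.cos t := by
  rw [← Complex.normSq_eq_norm_sq, Complex.normSq_apply]
  simp only [Complex.add_re, Complex.add_im, Complex.re_ofReal_mul, Complex.im_ofReal_mul,
    Complex.exp_ofReal_mul_I_re, Complex.exp_ofReal_mul_I_im, Complex.ofReal_re,
    Complex.ofReal_im, add_zero]
  nlinarith [Real.sin_sq_add_cos_sq t]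

/-- The arc of the circle of radius `r` about `-d` that is outside the ball of radius `R`. -/
lemma volume_arc {R d r : ℝ} (hR : 0 < R) (hd : 0 < d) (hr : 0 < r) :
    volume (Set.Ioo (-Real.pi) Real.pi ∩
      {t : ℝ | R < ‖(r : ℂ) * Complex.exp (t * Complex.I) + d‖}) =
      ENNReal.ofReal (2 * Real.arccos ((R ^ 2 - d ^ 2 - r ^ 2) / (2 * d * r))) := by
  set c := (R ^ 2 - d ^ 2 - r ^ 2) / (2 * d * r) with hc
  have hset : Set.Ioo (-Real.pi) Real.pi ∩
      {t : ℝ | R < ‖(r : ℂ) * Complex.exp (t * Complex.I) + d‖} =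
      Set.Ioo (-Real.arccos c) (Real.arccos c) := by
    ext t
    have h1 : R < ‖(r : ℂ) * Complex.exp (t * Complex.I) + d‖ ↔ c < Real.cos t := by
      rw [← pow_lt_pow_iff_left₀ hR.le (norm_nonneg _) two_ne_zero, norm_mul_exp_add_sq, hc,
        div_lt_iff₀ (by positivity)]
      constructor <;> intro h <;> nlinarith
    rw [Set.mem_inter_iff, Set.mem_Ioo, Set.mem_Ioo, ← abs_lt, ← abs_lt]
    change _ ∧ R < _ ↔ _
    rw [h1]
    constructor
    · rintro ⟨ht, h⟩
      exact (abs_lt_arccos_iff ht).2 h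
    · intro h
      have ht := h.trans_le (Real.arccos_le_pi c)
      exact ⟨ht, (abs_lt_arccos_iff ht).1 h⟩
  rw [hset, Real.volume_Ioo]
  congr 1
  ring

/-- Radial integration about `z` over the exterior of a ball centred at the origin. -/
lemma lintegral_radial_exterior {R d : ℝ} (hR : 0 < R) (hd : 0 < d) {z : ℂ} (hz : ‖z‖ = d)
    {F : ℝ → ℝ≥0∞} (hF : Measurable F) :
    ∫⁻ x in (Metric.closedBall (0 : ℂ) R)ᶜ, F ‖x - z‖ =
      ∫⁻ y in Set.Ioi (0 : ℝ), ENNReal.ofReal y * (F y *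
        ENNReal.ofReal (2 * Real.arccos ((R ^ 2 - d ^ 2 - y ^ 2) / (2 * d * y)))) := by
  have hdC : (d : ℂ) ≠ 0 := by exact_mod_cast hd.ne'
  have hu : ‖z / d‖ = 1 := by
    rw [norm_div, hz, Complex.norm_real, Real.norm_of_nonneg hd.le, div_self hd.ne']
  set g : ℂ → ℝ≥0∞ := fun w => {w : ℂ | R < ‖w + d‖}.indicator (fun w => F ‖w‖) w with hg
  have hSm : MeasurableSet {w : ℂ | R < ‖w + d‖} := measurableSet_lt (by fun_prop) (by fun_prop)
  have hgm : Measurable g := Measurable.indicator (by fun_prop) hSm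
  -- The isometry `w ↦ (z / d) (w + d)` sends `0` to `z` and `-d` to the origin. It reduces the
  -- claim to polar coordinates about `0` with the ball centred at `-d`.
  set c : Circle := ⟨z / d, by simpa [Submonoid.unitSphere] using hu⟩
  have hmp : MeasurePreserving (fun w : ℂ => rotation c (w + d)) :=
    (rotation c).measurePreserving.comp (measurePreserving_add_right volume (d : ℂ))
  have hmeas : MeasurableSet (Metric.closedBall (0 : ℂ) R)ᶜ :=
    Metric.isClosed_closedBall.measurableSet.compl
  rw [← lintegral_indicator hmeas, ← hmp.lintegral_comp
    (Measurable.indicator (by fun_prop) hmeas)]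
  have h1 : ∀ w : ℂ, (Metric.closedBall (0 : ℂ) R)ᶜ.indicator (fun x => F ‖x - z‖)
      (rotation c (w + d)) = g w := by
    intro w
    have hn : ‖rotation c (w + d)‖ = ‖w + d‖ := (rotation c).norm_map _
    have hn2 : ‖rotation c (w + d) - z‖ = ‖w‖ := by
      have : z = rotation c d := by
        rw [rotation_apply]
        exact (div_mul_cancel₀ z hdC).symm
      conv_lhs => rw [this]
      rw [← map_sub, add_sub_cancel_right, (rotation c).norm_map]
    simp only [hg, Set.indicator, Set.mem_compl_iff, mem_closedBall_zero_iff, hn, hn2, not_le,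
      Set.mem_ofPred_eq]
  rw [lintegral_congr h1, lintegral_complex_polar hgm]
  refine setLIntegral_congr_fun measurableSet_Ioi fun r hr => ?_
  have hr' : (0 : ℝ) < r := hr
  have hTm : MeasurableSet {t : ℝ | R < ‖(r : ℂ) * Complex.exp (t * Complex.I) + d‖} :=
    measurableSet_lt (by fun_prop) (by fun_prop)
  have h2 : ∀ t : ℝ, g (r * Complex.exp (t * Complex.I)) =
      {t : ℝ | R < ‖(r : ℂ) * Complex.exp (t * Complex.I) + d‖}.indicator (fun _ => F r) t := by
    intro t
    have : ‖(r : ℂ) * Complex.exp (t * Complex.I)‖ = r := by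
      rw [norm_mul, Complex.norm_exp_ofReal_mul_I, Complex.norm_real,
        Real.norm_of_nonneg hr'.le, mul_one]
    simp only [hg, Set.indicator, Set.mem_ofPred_eq, this]
  simp_rw [h2]
  rw [lintegral_indicator_const hTm, Measure.restrict_apply hTm, Set.inter_comm,
    volume_arc hR hd hr']

/-- Radial integration about the origin over the exterior of a ball centred at the origin. -/
lemma lintegral_radial_exterior_zero {R : ℝ} (hR : 0 < R) {F : ℝ → ℝ≥0∞} (hF : Measurable F) :
    ∫⁻ x in (Metric.closedBall (0 : ℂ) R)ᶜ, F ‖x‖ =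
      ∫⁻ y in Set.Ioi R, ENNReal.ofReal y * (F y * ENNReal.ofReal (2 * Real.pi)) := by
  have hmeas : MeasurableSet (Metric.closedBall (0 : ℂ) R)ᶜ :=
    Metric.isClosed_closedBall.measurableSet.compl
  rw [← lintegral_indicator hmeas,
    lintegral_complex_polar (Measurable.indicator (by fun_prop) hmeas),
    ← Set.inter_eq_left.2 (Set.Ioi_subset_Ioi hR.le),
    ← Measure.restrict_restrict (measurableSet_Ioi : MeasurableSet (Set.Ioi R)),
    ← lintegral_indicator (measurableSet_Ioi : MeasurableSet (Set.Ioi R))]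
  refine setLIntegral_congr_fun measurableSet_Ioi fun r hr => ?_
  have hr' : (0 : ℝ) < r := hr
  have hn : ∀ t : ℝ, ‖(r : ℂ) * Complex.exp (t * Complex.I)‖ = r := fun t => by
    rw [norm_mul, Complex.norm_exp_ofReal_mul_I, Complex.norm_real,
      Real.norm_of_nonneg hr'.le, mul_one]
  have h : ∀ t : ℝ, (Metric.closedBall (0 : ℂ) R)ᶜ.indicator (fun x => F ‖x‖)
      (r * Complex.exp (t * Complex.I)) = (Set.Ioi R).indicator F r := by
    intro t
    simp only [Set.indicator, Set.mem_compl_iff, mem_closedBall_zero_iff, hn, not_le, Set.mem_Ioi]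
  simp_rw [h]
  rw [lintegral_const, Measure.restrict_apply_univ, Real.volume_Ioo, sub_neg_eq_add, ← two_mul]
  by_cases hR' : r ∈ Set.Ioi R <;> simp [hR']

end Geometry

/-! ### Convergence and evaluation of the explicit integrals -/

section Integrals

variable {P₁ P₂ α d R θ : ℝ}

lemma fullIntegrand_nonneg (hP₁ : 0 < P₁) (hP₂ : 0 < P₂) (hd : 0 < d) (hθ : 0 < θ) {y : ℝ}
    (hy : 0 < y) : 0 ≤ fullIntegrand P₁ P₂ α d θ y := by
  unfold fullIntegrand
  positivity

/-- Controls the integrand near `0`, where `y ^ (-α + 1)` is not integrable for `α > 2`: the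
fraction multiplying `2πy` is at most one. -/
lemma fullIntegrand_le_mul (hP₁ : 0 < P₁) (hP₂ : 0 < P₂) (hd : 0 < d) (hθ : 0 < θ) {y : ℝ}
    (hy : 0 < y) : fullIntegrand P₁ P₂ α d θ y ≤ 2 * Real.pi * y := by
  unfold fullIntegrand
  rw [div_le_iff₀ (by positivity), Real.rpow_add hy, Real.rpow_one]
  have : 0 ≤ 2 * Real.pi * y * P₂ := by positivity
  nlinarith

/-- Controls the tail, where the power is integrable for `α > 2`. -/
lemma fullIntegrand_le_rpow (hP₁ : 0 < P₁) (hP₂ : 0 < P₂) (hd : 0 < d) (hθ : 0 < θ) {y : ℝ}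
    (hy : 0 < y) : fullIntegrand P₁ P₂ α d θ y ≤
      2 * Real.pi * (P₁ * θ) * d ^ α / P₂ * y ^ (-α + 1) := by
  unfold fullIntegrand
  rw [div_mul_eq_mul_div]
  exact div_le_div_of_nonneg_left (by positivity) hP₂ (le_add_of_nonneg_right (by positivity))

lemma arcIntegrand_nonneg (hP₁ : 0 < P₁) (hP₂ : 0 < P₂) (hd : 0 < d) (hθ : 0 < θ) {y : ℝ}
    (hy : 0 < y) : 0 ≤ arcIntegrand P₁ P₂ α d R θ y := by
  unfold arcIntegrand
  have := Real.arccos_nonneg ((R ^ 2 - d ^ 2 - y ^ 2) / (2 * d * y))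
  positivity

lemma arcIntegrand_le_fullIntegrand (hP₁ : 0 < P₁) (hP₂ : 0 < P₂) (hd : 0 < d) (hθ : 0 < θ)
    {y : ℝ} (hy : 0 < y) : arcIntegrand P₁ P₂ α d R θ y ≤ fullIntegrand P₁ P₂ α d θ y := by
  unfold arcIntegrand fullIntegrand
  have := Real.arccos_le_pi ((R ^ 2 - d ^ 2 - y ^ 2) / (2 * d * y))
  gcongr

lemma measurable_fullIntegrand : Measurable (fullIntegrand P₁ P₂ α d θ) := by
  unfold fullIntegrand
  fun_prop

lemma measurable_arcIntegrand : Measurable (arcIntegrand P₁ P₂ α d R θ) := by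
  unfold arcIntegrand
  have := Real.continuous_arccos.measurable
  fun_prop

lemma integrableOn_fullIntegrand (hP₁ : 0 < P₁) (hP₂ : 0 < P₂) (hα : 2 < α) (hd : 0 < d)
    (hθ : 0 < θ) : IntegrableOn (fullIntegrand P₁ P₂ α d θ) (Set.Ioi 0) := by
  rw [← Set.Ioc_union_Ioi_eq_Ioi zero_le_one]
  have hle : ∀ {g : ℝ → ℝ} {s : Set ℝ}, MeasurableSet s → IntegrableOn g s →
      (∀ y ∈ s, 0 < y ∧ fullIntegrand P₁ P₂ α d θ y ≤ g y) →
      IntegrableOn (fullIntegrand P₁ P₂ α d θ) s := by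
    intro g s hs hg h
    refine Integrable.mono' hg measurable_fullIntegrand.aestronglyMeasurable ?_
    refine (ae_restrict_iff' hs).2 (.of_forall fun y hy => ?_)
    rw [Real.norm_of_nonneg (fullIntegrand_nonneg hP₁ hP₂ hd hθ (h y hy).1)]
    exact (h y hy).2
  refine IntegrableOn.union (hle measurableSet_Ioc (g := fun y => 2 * Real.pi * y) ?_ ?_)
    (hle measurableSet_Ioi
      (g := fun y => 2 * Real.pi * (P₁ * θ) * d ^ α / P₂ * y ^ (-α + 1)) ?_ ?_)
  · exact (Continuous.integrableOn_Icc (by fun_prop)).mono_set Set.Ioc_subset_Icc_self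
  · exact fun y hy => ⟨hy.1, fullIntegrand_le_mul hP₁ hP₂ hd hθ hy.1⟩
  · exact (integrableOn_Ioi_rpow_of_lt (by linarith) one_pos).const_mul _
  · intro y hy
    have hy' : 0 < y := one_pos.trans hy
    exact ⟨hy', fullIntegrand_le_rpow hP₁ hP₂ hd hθ hy'⟩

lemma integrableOn_arcIntegrand (hP₁ : 0 < P₁) (hP₂ : 0 < P₂) (hα : 2 < α) (hd : 0 < d)
    (hθ : 0 < θ) : IntegrableOn (arcIntegrand P₁ P₂ α d R θ) (Set.Ioi 0) := by
  refine Integrable.mono' (integrableOn_fullIntegrand hP₁ hP₂ hα hd hθ)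
    measurable_arcIntegrand.aestronglyMeasurable ?_
  refine (ae_restrict_iff' measurableSet_Ioi).2 (.of_forall fun y hy => ?_)
  rw [Real.norm_of_nonneg (arcIntegrand_nonneg hP₁ hP₂ hd hθ hy)]
  exact arcIntegrand_le_fullIntegrand hP₁ hP₂ hd hθ hy

/-- The circle of radius `y` about the receiver stays at distance at least `|y - d|` from the
origin, so it does not enter the ball; the argument of `arccos` is at most `-1`. -/
lemma arcIntegrand_eq_fullIntegrand {y : ℝ} (hd : 0 < d) (hy : 0 < y)
    (h : R ^ 2 ≤ (y - d) ^ 2) :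
    arcIntegrand P₁ P₂ α d R θ y = fullIntegrand P₁ P₂ α d θ y := by
  have : Real.arccos ((R ^ 2 - d ^ 2 - y ^ 2) / (2 * d * y)) = Real.pi := by
    rw [Real.arccos_eq_pi, div_le_iff₀ (by positivity)]
    nlinarith
  rw [arcIntegrand, fullIntegrand, this]

/-- The circle stays within distance `y + d` of the origin, so it lies in the closed ball; the
argument of `arccos` is at least `1`. -/
lemma arcIntegrand_eq_zero {y : ℝ} (hd : 0 < d) (hy : 0 < y) (h : (y + d) ^ 2 ≤ R ^ 2) :
    arcIntegrand P₁ P₂ α d R θ y = 0 := by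
  have : Real.arccos ((R ^ 2 - d ^ 2 - y ^ 2) / (2 * d * y)) = 0 := by
    rw [Real.arccos_eq_zero, le_div_iff₀ (by positivity)]
    nlinarith
  simp [arcIntegrand, this]

/-- Beyond `R + d` the circles enclose the ball and count in full. Below `|R - d|` they lie inside
the ball if `d ≤ R`, and the last interval is then degenerate; if `R ≤ d` they miss its interior and
count in full. -/
lemma integral_arcIntegrand (hP₁ : 0 < P₁) (hP₂ : 0 < P₂) (hα : 2 < α) (hd : 0 < d)
    (hθ : 0 < θ) (hR : 0 < R) :
    ∫ y in Set.Ioi 0, arcIntegrand P₁ P₂ α d R θ y =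
      (∫ y in Set.Ioi (R + d), fullIntegrand P₁ P₂ α d θ y) +
        (∫ y in |R - d|..(R + d), arcIntegrand P₁ P₂ α d R θ y) +
        ∫ y in (max 0 (R - d))..|R - d|, fullIntegrand P₁ P₂ α d θ y := by
  have hint := integrableOn_arcIntegrand (R := R) hP₁ hP₂ hα hd hθ
  have h0 : 0 ≤ |R - d| := abs_nonneg _
  have h1 : |R - d| ≤ R + d := abs_le.2 ⟨by linarith, by linarith⟩
  have e1 : ∫ y in Set.Ioi 0, arcIntegrand P₁ P₂ α d R θ y =
      (∫ y in (0 : ℝ)..|R - d|, arcIntegrand P₁ P₂ α d R θ y) +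
        ∫ y in Set.Ioi |R - d|, arcIntegrand P₁ P₂ α d R θ y := by
    rw [intervalIntegral.integral_of_le h0, ← setIntegral_union (Set.Ioc_disjoint_Ioi le_rfl)
      measurableSet_Ioi (hint.mono_set Set.Ioc_subset_Ioi_self)
      (hint.mono_set (Set.Ioi_subset_Ioi h0)), Set.Ioc_union_Ioi_eq_Ioi h0]
  have e2 : ∫ y in Set.Ioi |R - d|, arcIntegrand P₁ P₂ α d R θ y =
      (∫ y in |R - d|..(R + d), arcIntegrand P₁ P₂ α d R θ y) +
        ∫ y in Set.Ioi (R + d), arcIntegrand P₁ P₂ α d R θ y := by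
    rw [intervalIntegral.integral_of_le h1, ← setIntegral_union (Set.Ioc_disjoint_Ioi le_rfl)
      measurableSet_Ioi
      (hint.mono_set (Set.Ioc_subset_Ioi_self.trans (Set.Ioi_subset_Ioi h0)))
      (hint.mono_set (Set.Ioi_subset_Ioi (h0.trans h1))), Set.Ioc_union_Ioi_eq_Ioi h1]
  have e3 : ∫ y in Set.Ioi (R + d), arcIntegrand P₁ P₂ α d R θ y =
      ∫ y in Set.Ioi (R + d), fullIntegrand P₁ P₂ α d θ y := by
    refine setIntegral_congr_fun measurableSet_Ioi fun y hy => ?_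
    have hy' : R + d < y := hy
    exact arcIntegrand_eq_fullIntegrand hd (by linarith)
      (pow_le_pow_left₀ hR.le (by linarith) 2)
  have e4 : ∫ y in (0 : ℝ)..|R - d|, arcIntegrand P₁ P₂ α d R θ y =
      ∫ y in (max 0 (R - d))..|R - d|, fullIntegrand P₁ P₂ α d θ y := by
    rcases le_total d R with hdR | hdR
    · rw [max_eq_right (by linarith), abs_of_nonneg (by linarith), intervalIntegral.integral_same,
        intervalIntegral.integral_of_le (by linarith)]
      refine setIntegral_eq_zero_of_forall_eq_zero fun y hy => ?_
      exact arcIntegrand_eq_zero hd hy.1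
        (pow_le_pow_left₀ (by linarith [hy.1]) (by linarith [hy.2]) 2)
    · rw [max_eq_left (by linarith), intervalIntegral.integral_of_le h0,
        intervalIntegral.integral_of_le h0]
      refine setIntegral_congr_fun measurableSet_Ioc fun y hy => ?_
      have hy2 := hy.2
      rw [abs_of_nonpos (by linarith)] at hy2
      refine arcIntegrand_eq_fullIntegrand hd hy.1 ?_
      nlinarith [hy.1]
  rw [e1, e2, e3, e4]
  ring

/-- The Laplace factor of a link of length `r`. -/
lemma inv_one_add_pathGain (hP₁ : 0 < P₁) (hP₂ : 0 < P₂) (hd : 0 < d) (hθ : 0 < θ) {r : ℝ}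
    (hr : 0 < r) :
    (1 + ENNReal.ofReal (P₁ * θ * d ^ α / P₂) * ENNReal.ofReal r ^ (-α))⁻¹ =
      ENNReal.ofReal (P₂ / (P₂ + P₁ * θ * d ^ α * r ^ (-α))) := by
  rw [ENNReal.ofReal_rpow_of_pos hr, ← ENNReal.ofReal_mul (by positivity), ← ENNReal.ofReal_one,
    ← ENNReal.ofReal_add zero_le_one (by positivity), ← ENNReal.ofReal_inv_of_pos (by positivity)]
  congr 1
  field_simp

/-- One minus the Laplace factor, times the Jacobian `y` and the arc angle, is `arcIntegrand`. Its
integrability permits the passage to a real integral. -/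
lemma lintegral_exterior_eq_arcIntegrand (hP₁ : 0 < P₁) (hP₂ : 0 < P₂) (hα : 2 < α) (hd : 0 < d)
    (hθ : 0 < θ) (hR : 0 < R) {z : ℂ} (hz : ‖z‖ = d) :
    ∫⁻ x in (Metric.closedBall (0 : ℂ) R)ᶜ,
        (1 - (1 + ENNReal.ofReal (P₁ * θ * d ^ α / P₂) * ‖x - z‖ₑ ^ (-α))⁻¹) =
      ENNReal.ofReal (∫ y in Set.Ioi 0, arcIntegrand P₁ P₂ α d R θ y) := by
  have hF : Measurable fun y : ℝ =>
      1 - (1 + ENNReal.ofReal (P₁ * θ * d ^ α / P₂) * ENNReal.ofReal y ^ (-α))⁻¹ := by fun_prop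
  simp_rw [← ofReal_norm]
  rw [lintegral_radial_exterior hR hd hz hF,
    ofReal_integral_eq_lintegral_ofReal (integrableOn_arcIntegrand hP₁ hP₂ hα hd hθ)
      ((ae_restrict_iff' measurableSet_Ioi).2
        (.of_forall fun y hy => arcIntegrand_nonneg hP₁ hP₂ hd hθ hy))]
  refine setLIntegral_congr_fun measurableSet_Ioi fun y hy => ?_
  have hy' : (0 : ℝ) < y := hy
  have hr := Real.rpow_pos_of_pos hy' (-α)
  have hda := Real.rpow_pos_of_pos hd α
  rw [inv_one_add_pathGain hP₁ hP₂ hd hθ hy', ← ENNReal.ofReal_one,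
    ← ENNReal.ofReal_sub _ (by positivity), ← ENNReal.ofReal_mul, ← ENNReal.ofReal_mul hy'.le]
  · congr 1
    rw [arcIntegrand, Real.rpow_add hy', Real.rpow_one]
    field_simp
    ring
  · rw [sub_nonneg, div_le_one (by positivity)]
    exact le_add_of_nonneg_right (by positivity)

/-- The mean interference from outside the empty ball. -/
lemma lintegral_exterior_pathGain (hα : 2 < α) (hR : 0 < R) :
    ∫⁻ x in (Metric.closedBall (0 : ℂ) R)ᶜ, ‖x - 0‖ₑ ^ (-α) =
      ENNReal.ofReal (2 * Real.pi / (α - 2) * R ^ (2 - α)) := by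
  have hF : Measurable fun y : ℝ => ENNReal.ofReal y ^ (-α) := by fun_prop
  simp_rw [sub_zero, ← ofReal_norm]
  rw [lintegral_radial_exterior_zero hR hF]
  have hint := integrableOn_Ioi_rpow_of_lt (show 1 - α < -1 by linarith) hR
  have h1 : ∫⁻ y in Set.Ioi R, ENNReal.ofReal y *
      (ENNReal.ofReal y ^ (-α) * ENNReal.ofReal (2 * Real.pi)) =
      ∫⁻ y in Set.Ioi R, ENNReal.ofReal (2 * Real.pi * y ^ (1 - α)) := by
    refine setLIntegral_congr_fun measurableSet_Ioi fun y hy => ?_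
    have hy' : (0 : ℝ) < y := hR.trans hy
    rw [ENNReal.ofReal_rpow_of_pos hy', ← ENNReal.ofReal_mul (by positivity),
      ← ENNReal.ofReal_mul hy'.le, sub_eq_add_neg, Real.rpow_add hy', Real.rpow_one]
    congr 1
    ring
  rw [h1, ← ofReal_integral_eq_lintegral_ofReal (hint.const_mul _)
      ((ae_restrict_iff' measurableSet_Ioi).2 (.of_forall fun y hy => by
        have hy' : (0 : ℝ) < y := hR.trans hy
        positivity)), integral_const_mul, integral_Ioi_rpow_of_lt (by linarith) hR]
  congr 1
  rw [show 1 - α + 1 = 2 - α by ring]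
  have : α - 2 ≠ 0 := by linarith
  have h2 : 2 - α ≠ 0 := by linarith
  field_simp
  ring

lemma quadratic_nonneg (d R t : ℝ) : 0 ≤ R ^ 2 - 2 * d * R * Real.cos t + d ^ 2 := by
  nlinarith [Real.sin_sq_add_cos_sq t, sq_nonneg (R - d * Real.cos t), sq_nonneg (d * Real.sin t)]

lemma angularIntegrand_nonneg (hP₁ : 0 < P₁) (hP₂ : 0 < P₂) (hd : 0 < d) (hθ : 0 < θ) (t : ℝ) :
    0 ≤ angularIntegrand P₁ P₂ α d R θ t := by
  have := Real.rpow_nonneg (quadratic_nonneg d R t) (-α / 2)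
  unfold angularIntegrand
  positivity

lemma angularIntegrand_le_one (hP₁ : 0 < P₁) (hP₂ : 0 < P₂) (hd : 0 < d) (hθ : 0 < θ) (t : ℝ) :
    angularIntegrand P₁ P₂ α d R θ t ≤ 1 := by
  have := Real.rpow_nonneg (quadratic_nonneg d R t) (-α / 2)
  unfold angularIntegrand
  rw [div_le_one (by positivity)]
  exact le_add_of_nonneg_right (by positivity)

lemma measurable_angularIntegrand : Measurable (angularIntegrand P₁ P₂ α d R θ) := by
  unfold angularIntegrand
  fun_prop

lemma integrableOn_angularIntegrand (hP₁ : 0 < P₁) (hP₂ : 0 < P₂) (hd : 0 < d) (hθ : 0 < θ)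
    {s : Set ℝ} (hs : volume s ≠ ∞) : IntegrableOn (angularIntegrand P₁ P₂ α d R θ) s := by
  refine Measure.integrableOn_of_bounded (M := 1) hs
    measurable_angularIntegrand.aestronglyMeasurable (.of_forall fun t => ?_)
  rw [Real.norm_of_nonneg (angularIntegrand_nonneg hP₁ hP₂ hd hθ t)]
  exact angularIntegrand_le_one hP₁ hP₂ hd hθ t

lemma periodic_angularIntegrand :
    Function.Periodic (angularIntegrand P₁ P₂ α d R θ) (2 * Real.pi) := by
  intro t
  simp [angularIntegrand, Real.cos_add_two_pi]

lemma norm_circle_sub_sq (R t : ℝ) (z : ℂ) :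
    ‖(R : ℂ) * Complex.exp (t * Complex.I) - z‖ ^ 2 =
      R ^ 2 - 2 * ‖z‖ * R * Real.cos (t - z.arg) + ‖z‖ ^ 2 := by
  have hre : z.re = ‖z‖ * Real.cos z.arg := (Complex.norm_mul_cos_arg z).symm
  have him : z.im = ‖z‖ * Real.sin z.arg := (Complex.norm_mul_sin_arg z).symm
  rw [← Complex.normSq_eq_norm_sq, Complex.normSq_apply]
  simp only [Complex.sub_re, Complex.sub_im, Complex.re_ofReal_mul, Complex.im_ofReal_mul,
    Complex.exp_ofReal_mul_I_re, Complex.exp_ofReal_mul_I_im]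
  rw [hre, him, Real.cos_sub]
  linear_combination R ^ 2 * Real.sin_sq_add_cos_sq t + ‖z‖ ^ 2 * Real.sin_sq_add_cos_sq z.arg

/-- If the nearest transmitter sits exactly at the receiver, its path gain is `∞` in the model,
whereas the real power of `0` in `angularIntegrand` is `0`. The two expressions differ there, so
these angles must be null. -/
lemma ae_circle_ne (hR : 0 < R) (z : ℂ) :
    ∀ᵐ t : ℝ, (R : ℂ) * Complex.exp (t * Complex.I) ≠ z := by
  have hc : Set.Countable {t : ℝ | (R : ℂ) * Complex.exp (t * Complex.I) = z} := by
    rcases Set.eq_empty_or_nonempty {t : ℝ | (R : ℂ) * Complex.exp (t * Complex.I) = z} with h | h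
    · rw [h]
      exact Set.countable_empty
    · obtain ⟨s, hs⟩ := h
      refine (Set.countable_range fun n : ℤ => s + n * (2 * Real.pi)).mono fun t ht => ?_
      have hRC : (R : ℂ) ≠ 0 := by exact_mod_cast hR.ne'
      have he : Complex.exp (t * Complex.I) = Complex.exp (s * Complex.I) :=
        mul_left_cancel₀ hRC (Eq.trans ht (Eq.symm hs))
      obtain ⟨n, hn⟩ := Complex.exp_eq_exp_iff_exists_int.1 he
      refine ⟨n, ?_⟩
      have h2 := congrArg Complex.im hn
      simp at h2
      simpa using h2.symm
  exact hc.ae_notMem volume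

end Integrals

/-! ### Access probability and sensed level of the model -/

namespace EmptyBallModel

variable {Ω : Type*} [MeasurableSpace Ω] {μ : Measure Ω} {lam R : ℝ}

lemma lintegral_angle (M : EmptyBallModel μ lam R) {f : ℝ → ℝ≥0∞} (hf : Measurable f) :
    ∫⁻ ω, f (M.angle ω) ∂μ =
      ENNReal.ofReal (1 / (2 * Real.pi)) * ∫⁻ t in Set.Ioc 0 (2 * Real.pi), f t := by
  have h : μ.map M.angle = ProbabilityTheory.cond volume (Set.Icc 0 (2 * Real.pi)) := M.angle_law
  rw [← lintegral_map hf M.angle_measurable, h, ProbabilityTheory.cond, lintegral_smul_measure,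
    Real.volume_Icc, sub_zero, ← ENNReal.ofReal_inv_of_pos (by positivity), one_div,
    restrict_Ioc_eq_restrict_Icc]
  rfl

lemma lintegral_nearest (M : EmptyBallModel μ lam R) {P₁ P₂ α d θ : ℝ} (hP₁ : 0 < P₁)
    (hP₂ : 0 < P₂) (hd : 0 < d) (hθ : 0 < θ) (hR : 0 < R) {z : ℂ} (hz : ‖z‖ = d) :
    ∫⁻ ω, (1 + ENNReal.ofReal (P₁ * θ * d ^ α / P₂) * ‖M.nearestPos ω - z‖ₑ ^ (-α))⁻¹ ∂μ =
      ENNReal.ofReal (1 / (2 * Real.pi) *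
        ∫ t in (0 : ℝ)..(2 * Real.pi), angularIntegrand P₁ P₂ α d R θ t) := by
  have h2pi : 0 ≤ 2 * Real.pi := by positivity
  have hm : Measurable fun t : ℝ => (1 + ENNReal.ofReal (P₁ * θ * d ^ α / P₂) *
      ‖(R : ℂ) * Complex.exp (t * Complex.I) - z‖ₑ ^ (-α))⁻¹ := by fun_prop
  -- The direction of `z` only shifts the angle, which a full period does not notice; hence the
  -- answer depends on `‖z‖` alone.
  have hshift : ∫ t in (0 : ℝ)..(2 * Real.pi), angularIntegrand P₁ P₂ α d R θ t =
      ∫ t in Set.Ioc 0 (2 * Real.pi), angularIntegrand P₁ P₂ α d R θ (t - z.arg) := by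
    rw [← intervalIntegral.integral_of_le h2pi,
      intervalIntegral.integral_comp_sub_right (fun t => angularIntegrand P₁ P₂ α d R θ t)]
    have := (periodic_angularIntegrand (P₁ := P₁) (P₂ := P₂) (α := α) (d := d) (R := R)
      (θ := θ)).intervalIntegral_add_eq 0 (0 - z.arg)
    rw [zero_add] at this
    rw [this]
    congr 1
    ring
  have hint : IntegrableOn (fun t => angularIntegrand P₁ P₂ α d R θ (t - z.arg))
      (Set.Ioc 0 (2 * Real.pi)) := by
    refine Measure.integrableOn_of_bounded (M := 1) measure_Ioc_lt_top.ne
      (measurable_angularIntegrand.comp (by fun_prop)).aestronglyMeasurable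
      (.of_forall fun t => ?_)
    rw [Real.norm_of_nonneg (angularIntegrand_nonneg hP₁ hP₂ hd hθ _)]
    exact angularIntegrand_le_one hP₁ hP₂ hd hθ _
  rw [ENNReal.ofReal_mul (by positivity), hshift, ofReal_integral_eq_lintegral_ofReal hint
    (.of_forall fun t => angularIntegrand_nonneg hP₁ hP₂ hd hθ _)]
  refine (M.lintegral_angle hm).trans ?_
  congr 1
  refine lintegral_congr_ae (ae_restrict_of_ae ?_)
  filter_upwards [ae_circle_ne hR z] with t ht
  have hr : 0 < ‖(R : ℂ) * Complex.exp (t * Complex.I) - z‖ := norm_pos_iff.2 (sub_ne_zero.2 ht)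
  rw [← ofReal_norm, inv_one_add_pathGain hP₁ hP₂ hd hθ hr, angularIntegrand]
  have hsq := norm_circle_sub_sq R t z
  rw [hz] at hsq
  rw [← hsq, ← Real.rpow_natCast_mul hr.le]
  congr 5
  push_cast
  ring

lemma accessProb_eq_Ps [IsProbabilityMeasure μ] (M : EmptyBallModel μ lam R) {P₁ P₂ α d θ : ℝ}
    (hlam : 0 < lam) (hP₁ : 0 < P₁) (hP₂ : 0 < P₂) (hα : 2 < α) (hd : 0 < d) (hθ : 0 < θ)
    (hR : 0 < R) {z : ℂ} (hz : ‖z‖ = d) :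
    M.accessProb P₁ P₂ α z θ = Ps P₁ P₂ lam α d R θ := by
  have hz0 : z ≠ 0 := norm_pos_iff.1 (hz ▸ hd)
  have h := M.measure_lt_sir (P₁ := P₁) (α := α) hP₂ hθ hz0
  have harc : 0 ≤ ∫ y in Set.Ioi 0, arcIntegrand P₁ P₂ α d R θ y :=
    setIntegral_nonneg measurableSet_Ioi fun y hy => arcIntegrand_nonneg hP₁ hP₂ hd hθ hy
  have hang : 0 ≤ ∫ t in (0 : ℝ)..(2 * Real.pi), angularIntegrand P₁ P₂ α d R θ t :=
    intervalIntegral.integral_nonneg (by positivity)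
      fun t _ => angularIntegrand_nonneg hP₁ hP₂ hd hθ t
  rw [hz, M.lintegral_nearest hP₁ hP₂ hd hθ hR hz,
    lintegral_exterior_eq_arcIntegrand hP₁ hP₂ hα hd hθ hR hz, ← ENNReal.ofReal_mul hlam.le,
    expNeg_ofReal (by positivity), ← ENNReal.ofReal_mul (by positivity)] at h
  rw [accessProb, measureReal_def, h, ENNReal.toReal_ofReal (by positivity), Ps,
    integral_arcIntegrand hP₁ hP₂ hα hd hθ hR, neg_mul]

lemma nearestPos_enorm (M : EmptyBallModel μ lam R) (hR : 0 < R) (ω : Ω) :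
    ‖M.nearestPos ω - 0‖ₑ = ENNReal.ofReal R := by
  rw [sub_zero, nearestPos, ← ofReal_norm, norm_mul, Complex.norm_exp_ofReal_mul_I,
    Complex.norm_real, Real.norm_of_nonneg hR.le, mul_one]

/-- The nearest transmitter is always at distance `R` from the origin and contributes `R ^ (-α)`;
the others contribute the exterior integral of the path gain. Multiplying by `R ^ α / P₁` yields the
equation. -/
lemma sensesLevel_iff [IsProbabilityMeasure μ] (M : EmptyBallModel μ lam R) {P₁ α I : ℝ}
    (hlam : 0 < lam) (hP₁ : 0 < P₁) (hα : 2 < α) (hI : 0 < I) (hR : 0 < R) :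
    M.SensesLevel P₁ α I ↔ RadiusEquation P₁ lam α I R := by
  have hα' : 0 < α - 2 := by linarith
  rw [SensesLevel, M.lintegral_interference, lintegral_exterior_pathGain hα hR]
  simp_rw [M.nearestPos_enorm hR]
  rw [lintegral_const, measure_univ, mul_one, ENNReal.ofReal_rpow_of_pos hR,
    ← ENNReal.ofReal_mul hlam.le, ← ENNReal.ofReal_add (by positivity) (by positivity),
    ← ENNReal.ofReal_mul hP₁.le, ENNReal.ofReal_eq_ofReal_iff (by positivity) hI.le,
    RadiusEquation, Real.rpow_neg hR.le, Real.rpow_sub hR, Real.rpow_two]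
  have h1 : 0 < R ^ α := Real.rpow_pos_of_pos hR α
  field_simp
  constructor <;> intro h <;> linarith

end EmptyBallModel

/-! ### Solving the radius equation -/

section RadiusEquation

variable {P₁ lam α I : ℝ}

/-- Form used for uniqueness: for `α > 2` and `I / P₁ > 0` the left side strictly increases in `R`,
while the right side strictly decreases. -/
lemma radiusEquation_iff {R : ℝ} (hR : 0 < R) : RadiusEquation P₁ lam α I R ↔
    I / P₁ * R ^ (α - 2) - 2 * Real.pi * lam / (α - 2) = (R ^ 2)⁻¹ := by
  rw [RadiusEquation, Real.rpow_sub hR, Real.rpow_two]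
  have : R ^ 2 ≠ 0 := by positivity
  rw [← one_div, eq_div_iff this, sub_mul, mul_assoc (I / P₁),
    div_mul_cancel₀ _ this, sub_eq_zero]

lemma existsUnique_radiusEquation (hP₁ : 0 < P₁) (hlam : 0 < lam) (hα : 2 < α) (hI : 0 < I) :
    ∃! R : ℝ, 0 < R ∧ RadiusEquation P₁ lam α I R := by
  have hα' : 0 < α - 2 := by linarith
  have ha : 0 < I / P₁ := by positivity
  have hb : 0 < 2 * Real.pi * lam / (α - 2) := by positivity
  refine existsUnique_of_exists_of_unique ?_ ?_
  · set a := I / P₁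
    set b := 2 * Real.pi * lam / (α - 2)
    -- Chosen so that `a T^(α-2) ≥ b + 1` and `T ≥ 1`; then `a T^α - b T² - 1 ≥ T² - 1 ≥ 0`.
    set T : ℝ := max 1 (((b + 1) / a) ^ (α - 2)⁻¹)
    have hT1 : 1 ≤ T := le_max_left _ _
    have hTpos : 0 < T := one_pos.trans_le hT1
    have hT : b + 1 ≤ a * T ^ (α - 2) := by
      have : (b + 1) / a ≤ T ^ (α - 2) := by
        calc (b + 1) / a = (((b + 1) / a) ^ (α - 2)⁻¹) ^ (α - 2) :=
              (Real.rpow_inv_rpow (by positivity) hα'.ne').symm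
          _ ≤ T ^ (α - 2) := Real.rpow_le_rpow (by positivity) (le_max_right _ _) hα'.le
      rwa [div_le_iff₀' ha] at this
    have hcont : ContinuousOn (fun R : ℝ => a * R ^ α - b * R ^ 2 - 1) (Set.Icc 0 T) := by
      have : Continuous fun R : ℝ => R ^ α := Real.continuous_rpow_const (by linarith)
      fun_prop
    have h0 : (fun R : ℝ => a * R ^ α - b * R ^ 2 - 1) 0 ≤ 0 := by
      simp [Real.zero_rpow (by linarith : α ≠ 0)]
    have h1 : 0 ≤ (fun R : ℝ => a * R ^ α - b * R ^ 2 - 1) T := by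
      have : T ^ α = T ^ (α - 2) * T ^ 2 := by
        rw [← Real.rpow_two, ← Real.rpow_add hTpos]
        congr 1
        ring
      beta_reduce
      rw [this]
      nlinarith [one_le_pow₀ hT1 (n := 2)]
    obtain ⟨R, hR, hR0⟩ := intermediate_value_Icc hTpos.le hcont ⟨h0, h1⟩
    -- The root is not `0`, since the expression equals `-1` there.
    refine ⟨R, lt_of_le_of_ne hR.1 fun h => ?_, hR0⟩
    rw [← h] at hR0
    simp [Real.zero_rpow (by linarith : α ≠ 0)] at hR0
  · have key : ∀ R S : ℝ, 0 < R → RadiusEquation P₁ lam α I R → RadiusEquation P₁ lam α I S →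
        ¬ R < S := by
      intro R S hR h1 h2 hlt
      rw [radiusEquation_iff hR] at h1
      rw [radiusEquation_iff (hR.trans hlt)] at h2
      have h3 : R ^ (α - 2) < S ^ (α - 2) := Real.rpow_lt_rpow hR.le hlt hα'
      have h4 : (S ^ 2)⁻¹ < (R ^ 2)⁻¹ := by gcongr
      nlinarith
    rintro R S ⟨hR, h1⟩ ⟨hS, h2⟩
    exact le_antisymm (not_lt.1 (key S R hS h2 h1)) (not_lt.1 (key R S hR h1 h2))

/-- The equation is quadratic in `R²` with roots `(B ± S) / (2I)`. Since `S > B > 0`, only the plus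
sign gives a positive `R²`. -/
lemma radiusEquation_four_iff (hP₁ : 0 < P₁) (hlam : 0 < lam) (hI : 0 < I) {R : ℝ} (hR : 0 < R) :
    RadiusEquation P₁ lam 4 I R ↔ R = (2 * I) ^ (-(1 / 2) : ℝ) *
      (Real.pi * lam * P₁ +
        ((Real.pi * lam * P₁) ^ 2 + 4 * P₁ * I) ^ (1 / 2 : ℝ)) ^ (1 / 2 : ℝ) := by
  set B := Real.pi * lam * P₁ with hB
  have hBpos : 0 < B := by positivity
  set S := Real.sqrt (B ^ 2 + 4 * P₁ * I) with hS
  have hSsq : S ^ 2 = B ^ 2 + 4 * P₁ * I := Real.sq_sqrt (by positivity)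
  have hSpos : 0 < S := Real.sqrt_pos.2 (by positivity)
  have hBS : B < S := by nlinarith [mul_pos hP₁ hI]
  rw [← Real.sqrt_eq_rpow, ← Real.sqrt_eq_rpow, ← hS, Real.rpow_neg (by positivity),
    ← Real.sqrt_eq_rpow, ← Real.sqrt_inv, ← Real.sqrt_mul (by positivity),
    eq_comm (a := R), Real.sqrt_eq_iff_mul_self_eq (by positivity) hR.le]
  have h4 : R ^ (4 : ℝ) = R ^ 4 := by exact_mod_cast Real.rpow_natCast R 4
  -- Multiplying by `4 I P₁` completes the square to `(2 I R² - B)² - S²`.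
  have h1 : RadiusEquation P₁ lam 4 I R ↔ (2 * I * R ^ 2 - B - S) * (2 * I * R ^ 2 - B + S) = 0 := by
    have : (2 * I * R ^ 2 - B - S) * (2 * I * R ^ 2 - B + S) =
        4 * I * P₁ * (I / P₁ * R ^ (4 : ℝ) - 2 * Real.pi * lam / (4 - 2) * R ^ 2 - 1) := by
      rw [h4]
      field_simp
      linear_combination (-2) * hSsq
    rw [this, RadiusEquation]
    have : 4 * I * P₁ ≠ 0 := by positivity
    simp [this]
  have h2 : 2 * I * R ^ 2 - B + S ≠ 0 := by
    have : 0 < I * R ^ 2 := by positivity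
    nlinarith
  rw [h1, mul_eq_zero, or_iff_left h2]
  have hI2 : 2 * I ≠ 0 := by positivity
  rw [inv_mul_eq_div, div_eq_iff hI2]
  constructor <;> intro h <;> linarith

end RadiusEquation

end SenseAndPredict

end

theorem proposition1 {Ω : Type*} [MeasurableSpace Ω] (μ : Measure Ω) [IsProbabilityMeasure μ]
    (P₁ P₂ lam₁ α d I θ : ℝ) (hP₁ : 0 < P₁) (hP₂ : 0 < P₂) (hlam₁ : 0 < lam₁) (hα : 2 < α)
    (hd : 0 < d) (hI : 0 < I) (hθ : 0 < θ) :
    (∃! R : ℝ, 0 < R ∧ SenseAndPredict.RadiusEquation P₁ lam₁ α I R) ∧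
    ∀ R : ℝ, 0 < R →
      -- all the integrals in the explicit expression converge
      (IntervalIntegrable (SenseAndPredict.angularIntegrand P₁ P₂ α d R θ) volume
          0 (2 * Real.pi) ∧
        IntegrableOn (SenseAndPredict.fullIntegrand P₁ P₂ α d θ) (Set.Ioi (R + d)) ∧
        IntervalIntegrable (SenseAndPredict.arcIntegrand P₁ P₂ α d R θ) volume
          |R - d| (R + d) ∧
        IntervalIntegrable (SenseAndPredict.fullIntegrand P₁ P₂ α d θ) volume
          (max 0 (R - d)) |R - d|) ∧
      -- the radius equation has the closed-form solution for `α = 4`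
      (α = 4 → (SenseAndPredict.RadiusEquation P₁ lam₁ α I R ↔
        R = (2 * I) ^ (-(1 / 2) : ℝ) *
          (Real.pi * lam₁ * P₁ +
            ((Real.pi * lam₁ * P₁) ^ 2 + 4 * P₁ * I) ^ (1 / 2 : ℝ)) ^ (1 / 2 : ℝ))) ∧
      ∀ M : SenseAndPredict.EmptyBallModel μ lam₁ R,
        -- the sensed level determines the radius
        (M.SensesLevel P₁ α I ↔ SenseAndPredict.RadiusEquation P₁ lam₁ α I R) ∧
        -- the access probability of a receiver at distance `d`
        (M.SensesLevel P₁ α I → ∀ z : ℂ, ‖z‖ = d →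
          M.accessProb P₁ P₂ α z θ = SenseAndPredict.Ps P₁ P₂ lam₁ α d R θ) := by
  refine ⟨SenseAndPredict.existsUnique_radiusEquation hP₁ hlam₁ hα hI, fun R hR => ⟨?_, ?_, ?_⟩⟩
  · have hfull := SenseAndPredict.integrableOn_fullIntegrand hP₁ hP₂ hα hd hθ
    have harc := SenseAndPredict.integrableOn_arcIntegrand (R := R) hP₁ hP₂ hα hd hθ
    have h0 : 0 ≤ |R - d| := abs_nonneg _
    refine ⟨?_, hfull.mono_set (Set.Ioi_subset_Ioi (by positivity)), ?_, ?_⟩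
    · rw [intervalIntegrable_iff_integrableOn_Ioc_of_le (by positivity)]
      exact SenseAndPredict.integrableOn_angularIntegrand hP₁ hP₂ hd hθ measure_Ioc_lt_top.ne
    · rw [intervalIntegrable_iff_integrableOn_Ioc_of_le (abs_le.2 ⟨by linarith, by linarith⟩)]
      exact harc.mono_set (Set.Ioc_subset_Ioi_self.trans (Set.Ioi_subset_Ioi h0))
    · rw [intervalIntegrable_iff_integrableOn_Ioc_of_le (max_le h0 (le_abs_self _))]
      exact hfull.mono_set
        (Set.Ioc_subset_Ioi_self.trans (Set.Ioi_subset_Ioi (le_max_left _ _)))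
  · rintro rfl
    exact SenseAndPredict.radiusEquation_four_iff hP₁ hlam₁ hI hR
  · exact fun M => ⟨M.sensesLevel_iff hlam₁ hP₁ hα hI hR,
      fun _ z hz => M.accessProb_eq_Ps hlam₁ hP₁ hP₂ hα hd hθ hR hz⟩
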